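/- Consider the two-user real Gaussian Z-interference channel $Y_1 = h_{11}X_1 + h_{21}X_2 + Z_1$, $Y_2 = h_{22}X_2 + Z_2$, with $Z_1, Z_2$ white Gaussian noises of unit variance and average power constraints $P_1, P_2 \ge 0$ on the codewords of the two transmitters. A key $K$, uniform on $\{1,\dots,2^{nR_K}\}$ with $R_K\ge 0$, is known to transmitter 2 and receiver 2 only; the messages $W_i$ are uniform on $\{1,\dots,2^{nR_i}\}$ (these numbers are rounded down to integers), and $W_1$, $W_2$, $K$ and the noises are independent. A pair $(R_1,R_2)$ of nonnegative rates is achieved by a sequence of codes of block length $n=0,1,2,\dots$ if the power constraints hold, the probability that receiver 1 or receiver 2 decodes its own message incorrectly tends to $0$, and $I(W_2;Y_1^n)\le n\epsilon_n$ with $\epsilon_n\to 0$ (weak secrecy). For $\beta_1,\beta_2\in[0,1]$ let $\mathcal R(\beta_1,\beta_2)$ be the set of all $(R_1,R_2)$ with $R_1,R_2\ge 0$ and $$R_1\le \tfrac12\log_2\Bigl(1+\frac{h_{11}^2\beta_1P_1}{1+h_{21}^2\beta_2P_2}\Bigr),\qquad R_2\le\min\Bigl\{R_K,\ \tfrac12\log_2\bigl(1+h_{22}^2\beta_2P_2\bigr)\Bigr\}.$$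 Then every point of the convex hull of $\bigcup_{\beta_1,\beta_2\in[0,1]}\mathcal R(\beta_1,\beta_2)$ is achievable in the usual sense, that is, it belongs to the closure of the set of rate pairs achieved by sequences of codes of the following kind: (i) the key is used as a one-time pad: transmitter 2 sends a codeword that depends only on the encrypted message $W_2\oplus K$ (addition modulo the number of messages $W_2$), and receiver 2 estimates the encrypted message from $Y_2^n$ alone and then removes the key; (ii) receiver 1 treats interference as noise: there is a power allocation $q_1,\dots,q_n\in[0,P_2]$ of transmitter 2 over the block, respected by its codewords (over the set of times with the same allotted power $p$, each codeword of transmitter 2 has average power at most $p$), and receiver 1 uses the maximum likelihood decoder for its codebook in which $h_{21}X_{2,t}+Z_{1,t}$ is regarded as independent Gaussian noise of variance $1+h_{21}^2q_t$. -/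

import Mathlib

open MeasureTheory ProbabilityTheory Filter Topology

noncomputable section

namespace GaussianZIC

/-- Number of values of an index of rate `R` (bits per channel use) at block length `n`:
`2 ^ (n R)`, rounded down to an integer. -/
def numIdx (R : ℝ) (n : ℕ) : ℕ := ⌊(2 : ℝ) ^ ((n : ℝ) * R)⌋₊

/-- The mutual information `I(X; Y)` (in nats): the relative entropy of the joint law with respect
to the product of the marginal laws. -/
def mutualInfo {Ω α β : Type*} [MeasurableSpace Ω] [MeasurableSpace α] [MeasurableSpace β]
    (P : Measure Ω) (X : Ω → α) (Y : Ω → β) : ENNReal :=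
  InformationTheory.klDiv (P.map (fun ω => (X ω, Y ω))) ((P.map X).prod (P.map Y))

/-- A block code of length `n` for the two-user Z-interference channel with a key shared by
transmitter 2 and receiver 2: `M₁`, `M₂` are the numbers of messages, `N` the number of keys. -/
structure Code (n M₁ M₂ N : ℕ) where
  /-- encoder of transmitter 1, which does not know the key -/
  enc₁ : Fin M₁ → Fin n → ℝ
  /-- encoder of transmitter 2, which knows the key -/
  enc₂ : Fin M₂ → Fin N → Fin n → ℝ
  /-- decoder of receiver 1, which does not know the key -/
  dec₁ : (Fin n → ℝ) → Fin M₁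
  /-- decoder of receiver 2, which knows the key -/
  dec₂ : (Fin n → ℝ) → Fin N → Fin M₂
  measurable_dec₁ : Measurable dec₁
  measurable_dec₂ : ∀ k, Measurable fun y => dec₂ y k

/-- The randomness of one block: the tuple `(W₁, W₂, K, Z₁, Z₂)` of the two messages, the key and
the two noise vectors. -/
abbrev Outcome (n M₁ M₂ N : ℕ) : Type :=
  Fin M₁ × Fin M₂ × Fin N × (Fin n → ℝ) × (Fin n → ℝ)

/-- The law of a vector of `n` independent standard Gaussian variables. -/
def noiseLaw (n : ℕ) : Measure (Fin n → ℝ) := Measure.pi fun _ => gaussianReal 0 1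

/-- The law of `(W₁, W₂, K, Z₁, Z₂)`: all five are independent, the messages and the key are
uniformly distributed, and each noise vector is white Gaussian of unit variance. -/
def blockLaw (n M₁ M₂ N : ℕ) : Measure (Outcome n M₁ M₂ N) :=
  (uniformOn (Set.univ : Set (Fin M₁))).prod
    ((uniformOn (Set.univ : Set (Fin M₂))).prod
      ((uniformOn (Set.univ : Set (Fin N))).prod ((noiseLaw n).prod (noiseLaw n))))

/-- Addition of the key to a message modulo the number `M` of messages. -/
def pad {M N : ℕ} (w : Fin M) (k : Fin N) : Fin M :=
  ⟨((w : ℕ) + (k : ℕ)) % M, Nat.mod_lt _ w.pos⟩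

namespace Code

variable {n M₁ M₂ N : ℕ}

/-- The output block at receiver 1, `Y₁ = h₁₁ X₁ + h₂₁ X₂ + Z₁`. -/
def out₁ (c : Code n M₁ M₂ N) (h₁₁ h₂₁ : ℝ) : Outcome n M₁ M₂ N → Fin n → ℝ :=
  fun ⟨w₁, w₂, k, z₁, _⟩ t => h₁₁ * c.enc₁ w₁ t + h₂₁ * c.enc₂ w₂ k t + z₁ t

/-- The output block at receiver 2, `Y₂ = h₂₂ X₂ + Z₂`. -/
def out₂ (c : Code n M₁ M₂ N) (h₂₂ : ℝ) : Outcome n M₁ M₂ N → Fin n → ℝ :=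
  fun ⟨_, w₂, k, _, z₂⟩ t => h₂₂ * c.enc₂ w₂ k t + z₂ t

/-- The average power constraints: every codeword of transmitter `i` has average power at most
`Pᵢ`. -/
def PowerConstraint (c : Code n M₁ M₂ N) (P₁ P₂ : ℝ) : Prop :=
  (∀ w, ∑ t, c.enc₁ w t ^ 2 ≤ n * P₁) ∧ ∀ w k, ∑ t, c.enc₂ w k t ^ 2 ≤ n * P₂

/-- The event that receiver 1 or receiver 2 decodes its message incorrectly. -/
def errorEvent (c : Code n M₁ M₂ N) (h₁₁ h₂₁ h₂₂ : ℝ) : Set (Outcome n M₁ M₂ N) :=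
  {ω | c.dec₁ (c.out₁ h₁₁ h₂₁ ω) ≠ ω.1 ∨ c.dec₂ (c.out₂ h₂₂ ω) ω.2.2.1 ≠ ω.2.1}

/-- The information `I(W₂; Y₁ⁿ)` about the message of user 2 that leaks to receiver 1. -/
def leakage (c : Code n M₁ M₂ N) (h₁₁ h₂₁ : ℝ) : ENNReal :=
  mutualInfo (blockLaw n M₁ M₂ N) (fun ω => ω.2.1) (c.out₁ h₁₁ h₂₁)

/-- The key is used as a one-time pad: transmitter 2 sends the codeword `x (W₂ ⊕ K)` of the
encrypted message, and receiver 2 estimates the encrypted message from its output alone and then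
removes the key. -/
def IsOneTimePad (c : Code n M₁ M₂ N) : Prop :=
  (∃ x : Fin M₂ → Fin n → ℝ, ∀ w k, c.enc₂ w k = x (pad w k)) ∧
    ∃ d : (Fin n → ℝ) → Fin M₂, ∀ y k, pad (c.dec₂ y k) k = d y

/-- Receiver 1 treats interference as noise: transmitter 2 has a power allocation `q` over the
block, with values in `[0, P₂]`, which its codewords respect (over the set of times with the same
allotted power `p`, the average power of each codeword is at most `p`), and receiver 1 decodes as
if the interference at time `t` were Gaussian noise of power `h₂₁² q t`. That is, it uses the
maximum likelihood decoder of the channel `Y = h₁₁ X₁ + V`, where the `V t` are independent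
Gaussian variables with mean zero and variance `1 + h₂₁² q t`. -/
def TreatsInterferenceAsNoise (c : Code n M₁ M₂ N) (h₁₁ h₂₁ P₂ : ℝ) : Prop :=
  ∃ q : Fin n → ℝ, (∀ t, 0 ≤ q t ∧ q t ≤ P₂) ∧
    (∀ w k s, ∑ t with q t = q s, c.enc₂ w k t ^ 2 ≤ ∑ t with q t = q s, q t) ∧
    ∀ y w, ∑ t, (y t - h₁₁ * c.enc₁ (c.dec₁ y) t) ^ 2 / (1 + h₂₁ ^ 2 * q t) ≤
      ∑ t, (y t - h₁₁ * c.enc₁ w t) ^ 2 / (1 + h₂₁ ^ 2 * q t)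

end Code

/-- The rate pairs `(R₁, R₂)` for which there are codes, one for each block length `n`, with
`2 ^ (n Rᵢ)` messages of user `i` and `2 ^ (n R_K)` keys, that use the key as a one-time pad, treat
interference as noise at receiver 1, satisfy the power constraints, have vanishing probability of
error, and are weakly secure: `I(W₂; Y₁ⁿ) ≤ n ε n` with `ε n → 0`. -/
def oneTimePadAchievable (h₁₁ h₂₁ h₂₂ P₁ P₂ RK : ℝ) : Set (ℝ × ℝ) :=
  {R | 0 ≤ R.1 ∧ 0 ≤ R.2 ∧
    ∃ c : ∀ n : ℕ, Code n (numIdx R.1 n) (numIdx R.2 n) (numIdx RK n),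
      (∀ n, (c n).PowerConstraint P₁ P₂) ∧
      (∀ n, (c n).IsOneTimePad) ∧
      (∀ n, (c n).TreatsInterferenceAsNoise h₁₁ h₂₁ P₂) ∧
      Tendsto (fun n => blockLaw n (numIdx R.1 n) (numIdx R.2 n) (numIdx RK n)
        ((c n).errorEvent h₁₁ h₂₁ h₂₂)) atTop (𝓝 0) ∧
      ∃ ε : ℕ → ℝ, Tendsto ε atTop (𝓝 0) ∧
        ∀ n, (c n).leakage h₁₁ h₂₁ ≤ ENNReal.ofReal (n * ε n)}

/-- The set of rate pairs for the power control parameters `β₁`, `β₂`. -/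
def rateRegion (h₁₁ h₂₁ h₂₂ P₁ P₂ RK β₁ β₂ : ℝ) : Set (ℝ × ℝ) :=
  {R | 0 ≤ R.1 ∧ 0 ≤ R.2 ∧
    R.1 ≤ 0.5 * Real.logb 2 (1 + h₁₁ ^ 2 * β₁ * P₁ / (1 + h₂₁ ^ 2 * β₂ * P₂)) ∧
    R.2 ≤ min RK (0.5 * Real.logb 2 (1 + h₂₂ ^ 2 * β₂ * P₂))}

end GaussianZIC

end

/-! A point of the convex hull is a combination, with positive weights `lam j`, of points of regions
with powers `p j`, `q j`. The block is divided into phases of relative lengths `lam j`, and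
transmitter 1 and transmitter 2 use the powers `p j`, `q j` in phase `j`. It suffices to reach rates
slightly below the averaged capacities, since the conclusion concerns a closure.

Reliability (`eventually_exists_codebook`) comes from one random Gaussian codebook over the whole
block, conditioned on the power constraints of the phases. The interference is a fixed codeword
rather than Gaussian noise, but at a given power Gaussian interference is the worst case: the
information density computed for Gaussian noise has a mean that decreases with the energy of the
actual interference, and equals the capacity when this energy reaches its allowance
(`measure_infoDensity_le`). The random coding bound `exists_codebook` and Chebyshev's inequality do
the rest.

Secrecy does not depend on the codebooks. The number of keys need not be a multiple of the number of
messages, so the encrypted message is not exactly independent of `W₂`. But the joint law is at most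
twice the product law (`map_prod_pad_le`), a domination that survives the channel to receiver 1.
Hence the leakage is at most `log 2` nats for every block length (`leakage_otpCode_le`), which
vanishes after division by `n`. -/

noncomputable section

/-! ### Relative entropy of dominated measures. -/

namespace InformationTheory

/-- A measure dominated by `c` times a probability measure has relative entropy at most `log c`. -/
theorem klDiv_le_ofReal_log {α : Type*} [MeasurableSpace α] {μ ν : Measure α}
    [IsProbabilityMeasure μ] [IsProbabilityMeasure ν] {c : ℝ} (hc : 0 < c)
    (h : μ ≤ ENNReal.ofReal c • ν) : klDiv μ ν ≤ ENNReal.ofReal (Real.log c) := by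
  have hac : μ ≪ ν := h.absolutelyContinuous.trans (Measure.smul_absolutelyContinuous)
  have hle : ∀ᵐ x ∂ν, μ.rnDeriv ν x ≤ ENNReal.ofReal c := by
    refine ae_le_of_forall_setLIntegral_le_of_sigmaFinite (Measure.measurable_rnDeriv μ ν) ?_
    intro s hs _
    rw [Measure.setLIntegral_rnDeriv hac, setLIntegral_const]
    simpa using h s
  have hlog : ∀ᵐ x ∂μ, llr μ ν x ≤ Real.log c := by
    filter_upwards [hac.ae_le hle, Measure.rnDeriv_pos hac,
      hac.ae_le (Measure.rnDeriv_lt_top μ ν)] with x h1 h2 h3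
    rw [llr]
    refine Real.log_le_log (ENNReal.toReal_pos h2.ne' h3.ne) ?_
    exact ENNReal.toReal_le_of_le_ofReal hc.le h1
  -- `klDiv` is infinite unless `llr` is integrable. Here `r log r` is bounded for `0 ≤ r ≤ c`,
  -- because `r - 1 ≤ r log r ≤ r (r - 1)` for `r > 0`.
  have hint : Integrable (llr μ ν) μ := by
    rw [← integrable_rnDeriv_smul_iff hac]
    have hb : ∀ᵐ x ∂ν, ‖(μ.rnDeriv ν x).toReal • llr μ ν x‖ ≤ 1 + c * |Real.log c| + c ^ 2 := by
      filter_upwards [hle] with x h1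
      set r := (μ.rnDeriv ν x).toReal with hr
      have hr0 : 0 ≤ r := ENNReal.toReal_nonneg
      have hrc : r ≤ c := ENNReal.toReal_le_of_le_ofReal hc.le h1
      have : llr μ ν x = Real.log r := rfl
      rw [this, smul_eq_mul, Real.norm_eq_abs]
      rcases hr0.eq_or_lt with h0 | h0
      · rw [← h0]; simp; positivity
      · have h4 : 0 ≤ c * |Real.log c| := by positivity
        rw [abs_le]
        constructor
        · have := Real.one_sub_inv_le_log_of_pos h0
          have h5 : r * (1 - r⁻¹) = r - 1 := by field_simp
          nlinarith [mul_le_mul_of_nonneg_left this hr0, sq_nonneg c]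
        · have := Real.log_le_sub_one_of_pos h0
          nlinarith [mul_le_mul_of_nonneg_left this hr0, sq_nonneg c]
    refine Integrable.of_bound ?_ _ hb
    exact ((Measure.measurable_rnDeriv μ ν).ennreal_toReal.smul
      (measurable_llr μ ν)).aestronglyMeasurable
  rw [klDiv_of_ac_of_integrable hac hint]
  refine ENNReal.ofReal_le_ofReal ?_
  have : ∫ x, llr μ ν x ∂μ ≤ ∫ _, Real.log c ∂μ := integral_mono_ae hint (integrable_const _) hlog
  simpa using this

end InformationTheory

namespace GaussianZIC

/-! ### Selection of decoders, codes and phases. -/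

/-- A measurable selection of a minimizer of finitely many measurable real functions. -/
theorem exists_measurable_argmin {Y : Type*} [MeasurableSpace Y] {M : ℕ} (hM : 0 < M)
    (D : Fin M → Y → ℝ) (hD : ∀ w, Measurable (D w)) :
    ∃ d : Y → Fin M, Measurable d ∧ ∀ y w, D (d y) y ≤ D w y := by
  classical
  have hex : ∀ y, ∃ k : ℕ, ∃ hk : k < M, ∀ w, D ⟨k, hk⟩ y ≤ D w y := by
    intro y
    have : Nonempty (Fin M) := ⟨⟨0, hM⟩⟩
    obtain ⟨w, hw⟩ := Finite.exists_min (fun w => D w y)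
    exact ⟨w, w.2, hw⟩
  -- Ties are broken in favour of the least index, which keeps the selection measurable.
  have hmeas : Measurable fun y => Nat.find (hex y) := by
    refine measurable_find _ fun k => ?_
    by_cases hk : k < M
    · simp only [hk, exists_true_left]
      simp only [Set.ofPred_forall]
      exact MeasurableSet.iInter fun w => measurableSet_le (hD _) (hD w)
    · simp [hk]
  refine ⟨fun y => ⟨Nat.find (hex y), (Nat.find_spec (hex y)).1⟩, ?_, fun y w =>
    (Nat.find_spec (hex y)).2 w⟩
  refine measurable_to_countable' fun w => ?_
  have : (fun y => (⟨Nat.find (hex y), (Nat.find_spec (hex y)).1⟩ : Fin M)) ⁻¹' {w} =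
      (fun y => Nat.find (hex y)) ⁻¹' {(w : ℕ)} := by
    ext y; simp [Fin.ext_iff]
  rw [this]
  exact hmeas (measurableSet_singleton _)

/-- Choosing one element in each of a sequence of sets so that an `ENNReal`-valued cost, which
can be made eventually small, tends to zero. -/
theorem exists_seq_tendsto_zero {S : ℕ → Type*} (p : ∀ n, S n → Prop) (f : ∀ n, S n → ENNReal)
    (hne : ∀ n, ∃ c, p n c) (h : ∀ ε : ℝ, 0 < ε → ∀ᶠ n in atTop, ∃ c, p n c ∧
      f n c ≤ ENNReal.ofReal ε) :
    ∃ c : ∀ n, S n, (∀ n, p n (c n)) ∧ Tendsto (fun n => f n (c n)) atTop (𝓝 0) := by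
  -- The choice must not depend on `ε`. An element within `1 / (n + 1)` of the infimum serves all
  -- `ε` at once.
  set e : ℕ → ENNReal := fun n => ⨅ c : {c // p n c}, f n c with he
  have hex : ∀ n, ∃ c, p n c ∧ f n c ≤ e n + ENNReal.ofReal (1 / ((n : ℝ) + 1)) := by
    intro n
    by_cases ht : e n = ⊤
    · obtain ⟨c, hc⟩ := hne n
      exact ⟨c, hc, by simp [ht]⟩
    · have hlt : e n < e n + ENNReal.ofReal (1 / ((n : ℝ) + 1)) := by
        refine ENNReal.lt_add_right ht ?_
        simp only [ne_eq, ENNReal.ofReal_eq_zero, not_le]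
        positivity
      obtain ⟨c, hc⟩ := iInf_lt_iff.1 hlt
      exact ⟨c.1, c.2, hc.le⟩
  choose c hc hcf using hex
  refine ⟨c, hc, ?_⟩
  rw [ENNReal.tendsto_atTop_zero]
  intro ε hε
  obtain ⟨δ, hδ, hδε⟩ : ∃ δ : ℝ, 0 < δ ∧ ENNReal.ofReal (δ + δ) ≤ ε := by
    by_cases ht : ε = ⊤
    · exact ⟨1, one_pos, by simp [ht]⟩
    · refine ⟨ε.toReal / 2, by have := ENNReal.toReal_pos hε.ne' ht; positivity, ?_⟩
      rw [add_halves, ENNReal.ofReal_toReal ht]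
  have h1 := h δ hδ
  have h2 : ∀ᶠ n : ℕ in atTop, 1 / ((n : ℝ) + 1) < δ :=
    (tendsto_one_div_add_atTop_nhds_zero_nat (𝕜 := ℝ)).eventually_lt_const hδ
  obtain ⟨N, hN⟩ := eventually_atTop.1 (h1.and h2)
  refine ⟨N, fun n hn => ?_⟩
  obtain ⟨⟨b, hb, hbf⟩, h3⟩ := hN n hn
  calc f n (c n) ≤ e n + ENNReal.ofReal (1 / ((n : ℝ) + 1)) := hcf n
    _ ≤ ENNReal.ofReal δ + ENNReal.ofReal δ := by
        gcongr
        exact (iInf_le (fun c : {c // p n c} => f n c) ⟨b, hb⟩).trans hbf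
    _ = ENNReal.ofReal (δ + δ) := (ENNReal.ofReal_add hδ.le hδ.le).symm
    _ ≤ ε := hδε

/-- A block can be divided into phases of prescribed relative lengths, up to one time unit. -/
theorem exists_phases {J : Type*} [Fintype J] [DecidableEq J] (lam : J → ℝ) (hlam : ∀ j, 0 ≤ lam j)
    (hsum : ∑ j, lam j = 1) (n : ℕ) :
    ∃ φ : Fin n → J, ∀ j, n * lam j - 1 ≤ (Finset.univ.filter fun t => φ t = j).card := by
  have hJ : Nonempty J := by
    by_contra hJ
    rw [not_nonempty_iff] at hJ
    simp at hsum
  have hcard : Fintype.card (Σ j : J, Fin ⌊n * lam j⌋₊) ≤ Fintype.card (Fin n) := by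
    simp only [Fintype.card_sigma, Fintype.card_fin]
    have : (∑ j, (⌊n * lam j⌋₊ : ℝ)) ≤ n := by
      calc (∑ j, (⌊n * lam j⌋₊ : ℝ)) ≤ ∑ j, n * lam j :=
            Finset.sum_le_sum fun j _ => Nat.floor_le (by have := hlam j; positivity)
        _ = n := by rw [← Finset.mul_sum, hsum, mul_one]
    exact_mod_cast this
  obtain ⟨e⟩ := Function.Embedding.nonempty_of_card_le hcard
  -- Times left over by the rounding go to an arbitrary phase, so phase lengths are only bounded
  -- from below.
  refine ⟨Function.extend e Sigma.fst fun _ => Classical.arbitrary J, fun j => ?_⟩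
  have h1 : ⌊n * lam j⌋₊ ≤ (Finset.univ.filter fun t =>
      Function.extend e Sigma.fst (fun _ => Classical.arbitrary J) t = j).card := by
    rw [← Fintype.card_fin ⌊n * lam j⌋₊, ← Finset.card_univ]
    refine Finset.card_le_card_of_injOn (fun i => e ⟨j, i⟩) ?_ ?_
    · intro i _
      simp [e.injective.extend_apply]
    · intro i _ i' _ hii
      simpa using hii
  have h2 : n * lam j - 1 < ⌊n * lam j⌋₊ := Nat.sub_one_lt_floor _
  have h3 : (⌊n * lam j⌋₊ : ℝ) ≤ _ := Nat.cast_le.2 h1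
  linarith

/-! ### Random coding. -/

/-- **Random coding bound.** If `F x y` has mean at most `C` over the random input, then some
codebook has an average probability of at most `P (F < γ) + M C / γ` that another codeword has at
least the score `F` of the transmitted one. -/
theorem exists_codebook {X Y U : Type*} [MeasurableSpace X] [MeasurableSpace Y] [MeasurableSpace U]
    (μ : Measure X) [IsProbabilityMeasure μ] (κ : Measure U) [IsProbabilityMeasure κ]
    (f : X → U → Y) (hf : Measurable (Function.uncurry f))
    (F : X → Y → ENNReal) (hF : Measurable (Function.uncurry F)) (C γ : ENNReal)
    (hγ : γ ≠ 0) (hγ' : γ ≠ ⊤) (hC : ∀ y, ∫⁻ x, F x y ∂μ ≤ C)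
    (p : X → Prop) (hp : ∀ᵐ x ∂μ, p x) (M : ℕ) :
    ∃ x : Fin M → X, (∀ w, p (x w)) ∧
      ∑ w, κ {u | ∃ w', w' ≠ w ∧ F (x w) (f (x w) u) ≤ F (x w') (f (x w) u)} ≤
        M * ((μ.prod κ) {q | F q.1 (f q.1 q.2) < γ} + M * (C / γ)) := by
  classical
  set P : Measure (Fin M → X) := Measure.pi fun _ => μ with hPdef
  set a : X → ENNReal := fun x => κ {u | F x (f x u) < γ} with ha
  set b : X × X → ENNReal := fun x => κ {u | γ ≤ F x.2 (f x.1 u)} with hb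
  have hsa : MeasurableSet {q : X × U | F q.1 (f q.1 q.2) < γ} :=
    measurableSet_lt (hF.comp (measurable_fst.prodMk hf)) measurable_const
  have hsb : MeasurableSet {q : (X × X) × U | γ ≤ F q.1.2 (f q.1.1 q.2)} := by
    have h1 : Measurable fun q : (X × X) × U => (q.1.2, f q.1.1 q.2) :=
      (measurable_snd.comp measurable_fst).prodMk
        (hf.comp ((measurable_fst.comp measurable_fst).prodMk measurable_snd))
    exact measurableSet_le measurable_const (hF.comp h1)
  have hma : Measurable a := measurable_measure_prodMk_left hsa
  have hmb : Measurable b := measurable_measure_prodMk_left hsb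
  have hia : ∫⁻ x, a x ∂μ = (μ.prod κ) {q | F q.1 (f q.1 q.2) < γ} :=
    (Measure.prod_apply hsa).symm
  have hib : ∫⁻ x, b x ∂(μ.prod μ) ≤ C / γ := by
    rw [lintegral_prod _ hmb.aemeasurable]
    have hmeas : ∀ x, MeasurableSet {q : X × U | γ ≤ F q.1 (f x q.2)} := fun x =>
      measurableSet_le measurable_const
        (hF.comp (measurable_fst.prodMk (hf.comp (measurable_const.prodMk measurable_snd))))
    have h1 : ∀ x, ∫⁻ x', b (x, x') ∂μ ≤ C / γ := by
      intro x
      have h2 : ∫⁻ x', b (x, x') ∂μ = (μ.prod κ) {q | γ ≤ F q.1 (f x q.2)} :=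
        (Measure.prod_apply (hmeas x)).symm
      -- The rival codeword is averaged first, with the output fixed, so that Markov's inequality
      -- and `hC` apply.
      rw [h2, Measure.prod_apply_symm (hmeas x)]
      calc ∫⁻ u, μ ((fun x' => (x', u)) ⁻¹' {q | γ ≤ F q.1 (f x q.2)}) ∂κ
          ≤ ∫⁻ _, C / γ ∂κ := by
            refine lintegral_mono fun u => ?_
            have hFx : Measurable fun x' => F x' (f x u) :=
              hF.comp (measurable_id.prodMk measurable_const)
            exact (meas_ge_le_lintegral_div hFx.aemeasurable hγ hγ').trans
              (ENNReal.div_le_div_right (hC _) _)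
        _ = C / γ := by simp
    calc ∫⁻ x, ∫⁻ x', b (x, x') ∂μ ∂μ ≤ ∫⁻ _, C / γ ∂μ := lintegral_mono h1
      _ = C / γ := by simp
  set ψ : (Fin M → X) → ENNReal := fun x =>
    ∑ w, (a (x w) + ∑ w' ∈ Finset.univ.erase w, b (x w, x w')) with hψ
  have hψm : Measurable ψ := by fun_prop
  have hint : ∫⁻ x, ψ x ∂P ≤
      M * ((μ.prod κ) {q | F q.1 (f q.1 q.2) < γ} + M * (C / γ)) := by
    rw [lintegral_finsetSum _ (fun w _ => by fun_prop)]
    calc ∑ w, ∫⁻ x, (a (x w) + ∑ w' ∈ Finset.univ.erase w, b (x w, x w')) ∂P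
        ≤ ∑ _w : Fin M, ((μ.prod κ) {q | F q.1 (f q.1 q.2) < γ} + M * (C / γ)) := by
          refine Finset.sum_le_sum fun w _ => ?_
          rw [lintegral_add_left (by fun_prop), lintegral_finsetSum _ (fun w' _ => by fun_prop)]
          gcongr
          · rw [← hia]
            exact ((measurePreserving_eval (fun _ : Fin M => μ) w).lintegral_comp hma).le
          · calc ∑ w' ∈ Finset.univ.erase w, ∫⁻ x, b (x w, x w') ∂P
                ≤ ∑ _w' ∈ Finset.univ.erase w, C / γ := by
                  refine Finset.sum_le_sum fun w' hw' => ?_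
                  have hne : w ≠ w' := (Finset.ne_of_mem_erase hw').symm
                  have hind : IndepFun (fun x : Fin M → X => x w) (fun x => x w') P :=
                    (iIndepFun_pi (μ := fun _ : Fin M => μ) (X := fun _ x => x)
                      (fun _ => aemeasurable_id)).indepFun hne
                  have hmap := (indepFun_iff_map_prod_eq_prod_map_map
                    (measurable_pi_apply w).aemeasurable
                    (measurable_pi_apply w').aemeasurable).1 hind
                  have e1 : P.map (fun x => x w) = μ :=
                    (measurePreserving_eval (fun _ : Fin M => μ) w).map_eq
                  have e2 : P.map (fun x => x w') = μ :=
                    (measurePreserving_eval (fun _ : Fin M => μ) w').map_eq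
                  rw [e1, e2] at hmap
                  rw [← hmap, lintegral_map hmb (by fun_prop)] at hib
                  exact hib
              _ ≤ M * (C / γ) := by
                  rw [Finset.sum_const, nsmul_eq_mul]
                  gcongr
                  exact (Finset.card_le_univ _).trans (by simp)
      _ = _ := by simp [mul_add]
  have hnull : P {x | ∀ w, p (x w)}ᶜ = 0 := by
    have : ∀ᵐ x ∂P, ∀ w, p (x w) := by
      rw [ae_all_iff]
      intro w
      exact (measurePreserving_eval (fun _ : Fin M => μ) w).quasiMeasurePreserving.ae hp
    exact this
  -- Some codebook is no worse than the mean and also avoids the null set where `p` fails.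
  obtain ⟨x, hx, hxle⟩ := exists_notMem_null_le_lintegral hψm.aemeasurable hnull
  refine ⟨x, by simpa using hx, le_trans ?_ (hxle.trans hint)⟩
  refine Finset.sum_le_sum fun w _ => ?_
  calc κ {u | ∃ w', w' ≠ w ∧ F (x w) (f (x w) u) ≤ F (x w') (f (x w) u)}
      ≤ κ ({u | F (x w) (f (x w) u) < γ} ∪
          ⋃ w' ∈ Finset.univ.erase w, {u | γ ≤ F (x w') (f (x w) u)}) := by
        refine measure_mono ?_
        rintro u ⟨w', hw', hle⟩
        by_cases h : F (x w) (f (x w) u) < γ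
        · exact Or.inl h
        · right
          simp only [Set.mem_iUnion]
          exact ⟨w', by simpa using hw', (not_lt.1 h).trans hle⟩
    _ ≤ _ := (measure_union_le _ _).trans
        (by gcongr; exact measure_biUnion_finset_le _ _)

/-! ### Concentration of the information density. -/

/-- Chebyshev's inequality for a sum of independent terms `α j + v β j`, whose type `j` and
amplitude `v` vary from one term to the next. -/
theorem measure_sum_le_of_memLp {Ω J : Type*} [MeasurableSpace Ω] [Fintype J] (ρ : Measure Ω)
    [IsProbabilityMeasure ρ] (α β : J → Ω → ℝ) (hα : ∀ j, MemLp (α j) 2 ρ)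
    (hβ : ∀ j, MemLp (β j) 2 ρ) (hβ0 : ∀ j, ∫ ω, β j ω ∂ρ = 0) :
    ∃ K : ℝ, 0 ≤ K ∧ ∀ (n : ℕ) (φ : Fin n → J) (v : Fin n → ℝ) (a : ℝ), 0 < a →
      (Measure.pi fun _ : Fin n => ρ)
        {ω | ∑ t, (α (φ t) (ω t) + v t * β (φ t) (ω t)) ≤ ∑ t, (∫ ω, α (φ t) ω ∂ρ) - a} ≤
      ENNReal.ofReal (K * (∑ t, (1 + v t ^ 2)) / a ^ 2) := by
  refine ⟨2 * ∑ j, (variance (α j) ρ + variance (β j) ρ), ?_, ?_⟩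
  · exact mul_nonneg zero_le_two (Finset.sum_nonneg fun j _ =>
      add_nonneg (variance_nonneg _ _) (variance_nonneg _ _))
  intro n φ v a ha
  set P : Measure (Fin n → Ω) := Measure.pi fun _ => ρ with hP
  set X : Fin n → Ω → ℝ := fun t ω => α (φ t) ω + v t * β (φ t) ω with hX
  have hXm : ∀ t, MemLp (X t) 2 ρ := fun t => (hα _).add ((hβ _).const_mul _)
  have hmp : ∀ t, MeasurePreserving (fun ω : Fin n → Ω => ω t) P ρ := fun t =>
    measurePreserving_eval (fun _ => ρ) t
  have hXP : ∀ t, MemLp (fun ω : Fin n → Ω => X t (ω t)) 2 P := fun t =>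
    (hXm t).comp_measurePreserving (hmp t)
  have hS : MemLp (fun ω : Fin n → Ω => ∑ t, X t (ω t)) 2 P := memLp_finsetSum _ fun t _ => hXP t
  have hmean : ∫ ω, ∑ t, X t (ω t) ∂P = ∑ t, ∫ ω, α (φ t) ω ∂ρ := by
    rw [integral_finsetSum _ fun t _ => (hXP t).integrable (by norm_num)]
    refine Finset.sum_congr rfl fun t _ => ?_
    have h1 : ∫ ω, X t (ω t) ∂P = ∫ ω, X t ω ∂ρ := by
      rw [← (hmp t).map_eq, integral_map (hmp t).aemeasurable]
      rw [(hmp t).map_eq]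
      exact (hXm t).aestronglyMeasurable
    rw [h1, integral_add ((hα _).integrable (by norm_num))
      (((hβ _).integrable (by norm_num)).const_mul _), integral_const_mul, hβ0]
    simp
  have hvar : variance (fun ω : Fin n → Ω => ∑ t, X t (ω t)) P ≤
      (2 * ∑ j, (variance (α j) ρ + variance (β j) ρ)) * ∑ t, (1 + v t ^ 2) := by
    have h0 : variance (fun ω : Fin n → Ω => ∑ t, X t (ω t)) P = ∑ t, variance (X t) ρ := by
      have := variance_sum_pi (μ := fun _ : Fin n => ρ) (X := X) hXm
      rw [← this]
      congr 1
      ext ω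
      simp
    rw [h0, Finset.mul_sum]
    refine Finset.sum_le_sum fun t _ => ?_
    -- The variances of a sum and of a difference add up to twice the sum of the variances; this
    -- avoids the covariance.
    have h1 : variance (X t) ρ ≤ 2 * (variance (α (φ t)) ρ + v t ^ 2 * variance (β (φ t)) ρ) := by
      have e1 := variance_add (hα (φ t)) ((hβ (φ t)).const_mul (v t))
      have e2 := variance_sub (hα (φ t)) ((hβ (φ t)).const_mul (v t))
      have e3 := variance_nonneg (α (φ t) - fun ω => v t * β (φ t) ω) ρ
      have e4 : variance (fun ω => v t * β (φ t) ω) ρ = v t ^ 2 * variance (β (φ t)) ρ :=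
        variance_const_mul _ _ _
      have e5 : X t = α (φ t) + fun ω => v t * β (φ t) ω := rfl
      rw [e5]
      linarith
    have h2 : variance (α (φ t)) ρ + variance (β (φ t)) ρ ≤
        ∑ j, (variance (α j) ρ + variance (β j) ρ) :=
      Finset.single_le_sum (f := fun j => variance (α j) ρ + variance (β j) ρ)
        (fun j _ => add_nonneg (variance_nonneg _ _) (variance_nonneg _ _)) (Finset.mem_univ _)
    nlinarith [sq_nonneg (v t), variance_nonneg (α (φ t)) ρ, variance_nonneg (β (φ t)) ρ,
      mul_nonneg (sq_nonneg (v t)) (variance_nonneg (α (φ t)) ρ),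
      mul_le_mul_of_nonneg_right h2 (by positivity : 0 ≤ 1 + v t ^ 2)]
  calc P {ω | ∑ t, X t (ω t) ≤ ∑ t, (∫ ω, α (φ t) ω ∂ρ) - a}
      ≤ P {ω | a ≤ |∑ t, X t (ω t) - ∫ ω, ∑ t, X t (ω t) ∂P|} := by
        refine measure_mono fun ω hω => ?_
        simp only [Set.mem_ofPred_eq] at hω ⊢
        rw [hmean, abs_sub_comm]
        exact (by linarith : a ≤ _).trans (le_abs_self _)
    _ ≤ ENNReal.ofReal (variance (fun ω : Fin n → Ω => ∑ t, X t (ω t)) P / a ^ 2) :=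
        meas_ge_le_variance_div_sq hS ha
    _ ≤ _ := by gcongr

/-- The information density (in nats) between a standard Gaussian input `g` and the output `y` of
the channel with gain `b` and noise variance `N`. -/
def infoDensity (b N g y : ℝ) : ℝ :=
  Real.log (1 + b ^ 2 / N) / 2 - (y - b * g) ^ 2 / (2 * N) + y ^ 2 / (2 * (N + b ^ 2))

/-- The exponential is the likelihood of `y` given `g` divided by the output density at `y`.
Multiplied by the prior of `g` it is the posterior density, Gaussian with mean `b y / (N + b²)` and
variance `N / (N + b²)`. -/
theorem lintegral_exp_infoDensity (b y : ℝ) {N : ℝ} (hN : 0 < N) :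
    ∫⁻ g, ENNReal.ofReal (Real.exp (infoDensity b N g y)) ∂(gaussianReal 0 1) = 1 := by
  have hD : 0 < N + b ^ 2 := by positivity
  have hs : 0 < N / (N + b ^ 2) := by positivity
  set s : NNReal := ⟨N / (N + b ^ 2), hs.le⟩ with hsdef
  have hs0 : s ≠ 0 := by
    rw [← NNReal.coe_ne_zero]
    exact hs.ne'
  have hscoe : (s : ℝ) = N / (N + b ^ 2) := rfl
  rw [gaussianReal_of_var_ne_zero 0 one_ne_zero,
    lintegral_withDensity_eq_lintegral_mul _ (measurable_gaussianPDF 0 1)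
      (by unfold infoDensity; fun_prop),
    ← lintegral_gaussianPDF_eq_one (b * y / (N + b ^ 2)) hs0]
  refine lintegral_congr fun g => ?_
  simp only [Pi.mul_apply, gaussianPDF]
  rw [← ENNReal.ofReal_mul (gaussianPDFReal_nonneg _ _ _)]
  congr 1
  have e1 : Real.exp (infoDensity b N g y) = √(1 + b ^ 2 / N) *
      Real.exp (- (y - b * g) ^ 2 / (2 * N) + y ^ 2 / (2 * (N + b ^ 2))) := by
    rw [Real.sqrt_eq_rpow, Real.rpow_def_of_pos (by positivity), ← Real.exp_add, infoDensity]
    congr 1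
    ring
  have e2 : √(2 * Real.pi * (N / (N + b ^ 2))) * √(1 + b ^ 2 / N) = √(2 * Real.pi) := by
    rw [← Real.sqrt_mul (by positivity)]
    congr 1
    field_simp
  have h1 : 0 < √(2 * Real.pi * (N / (N + b ^ 2))) := by positivity
  have h2 : 0 < √(1 + b ^ 2 / N) := by positivity
  rw [e1, gaussianPDFReal, gaussianPDFReal, hscoe, NNReal.coe_one, mul_one, mul_one, ← e2, mul_inv]
  have e3 : ∀ p q r t : ℝ, q ≠ 0 → p⁻¹ * q⁻¹ * r * (q * t) = p⁻¹ * (r * t) := by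
    intro p q r t hq
    field_simp
  rw [e3 _ _ _ _ h2.ne', ← Real.exp_add]
  congr 2
  field_simp
  ring

theorem lintegral_exp_sum_infoDensity {n : ℕ} (b N y : Fin n → ℝ) (hN : ∀ t, 0 < N t) :
    ∫⁻ g, ENNReal.ofReal (Real.exp (∑ t, infoDensity (b t) (N t) (g t) (y t))) ∂(noiseLaw n) =
      1 := by
  have hm : ∀ t, Measurable fun g : ℝ =>
      ENNReal.ofReal (Real.exp (infoDensity (b t) (N t) g (y t))) := by
    intro t
    unfold infoDensity
    fun_prop
  have h1 : ∀ g : Fin n → ℝ,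
      ENNReal.ofReal (Real.exp (∑ t, infoDensity (b t) (N t) (g t) (y t))) =
      ∏ t, ENNReal.ofReal (Real.exp (infoDensity (b t) (N t) (g t) (y t))) := by
    intro g
    rw [Real.exp_sum, ENNReal.ofReal_prod_of_nonneg fun _ _ => (Real.exp_pos _).le]
  simp_rw [h1]
  have hind := iIndepFun_pi (μ := fun _ : Fin n => gaussianReal 0 1)
    (X := fun t g => ENNReal.ofReal (Real.exp (infoDensity (b t) (N t) g (y t))))
    (fun t => (hm t).aemeasurable)
  rw [noiseLaw, lintegral_prod_eq_prod_lintegral_of_indepFun Finset.univ _ hind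
    (fun t => (hm t).comp (measurable_pi_apply t))]
  refine Finset.prod_eq_one fun t _ => ?_
  rw [(measurePreserving_eval (fun _ : Fin n => gaussianReal 0 1) t).lintegral_comp (hm t)]
  exact lintegral_exp_infoDensity _ _ (hN t)

theorem integral_sq_gaussianReal : ∫ x, x ^ 2 ∂(gaussianReal 0 1) = 1 := by
  have h := variance_eq_integral (μ := gaussianReal 0 1) (X := id) aemeasurable_id
  rw [variance_id_gaussianReal] at h
  simpa using h.symm

/-- Hölder's inequality with these exponents puts products of two Gaussian variables in `L²`, as
Chebyshev's inequality requires. -/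
instance holderTriple_four_four_two : ENNReal.HolderTriple 4 4 2 := by
  constructor
  rw [← two_mul, show (4 : ENNReal) = 2 * 2 by norm_num, ENNReal.mul_inv (by simp) (by simp),
    ← mul_assoc, ENNReal.mul_inv_cancel (by simp) (by simp), one_mul]

theorem memLp_sq_gaussianReal : MemLp (fun x : ℝ => x ^ 2) 2 (gaussianReal 0 1) := by
  have h : MemLp (fun x : ℝ => x) 4 (gaussianReal 0 1) := memLp_id_gaussianReal' 4 (by simp)
  have h2 := h.mul (r := 2) h
  have e : (fun x : ℝ => x ^ 2) = (fun x => x) * fun x => x := by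
    ext x
    simp [pow_two]
  rwa [e]

theorem memLp_mul_gaussianReal_prod :
    MemLp (fun q : ℝ × ℝ => q.1 * q.2) 2 ((gaussianReal 0 1).prod (gaussianReal 0 1)) := by
  have h : MemLp (fun x : ℝ => x) 4 (gaussianReal 0 1) := memLp_id_gaussianReal' 4 (by simp)
  exact (h.comp_snd (gaussianReal 0 1)).mul (r := 2) (h.comp_fst (gaussianReal 0 1))

theorem sum_comp_eq_sum_card {n : ℕ} {J : Type*} [Fintype J] [DecidableEq J] (φ : Fin n → J)
    (f : J → ℝ) : ∑ t, f (φ t) = ∑ j, ((Finset.univ.filter fun t => φ t = j).card : ℝ) * f j := by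
  rw [← Finset.sum_fiberwise Finset.univ φ]
  refine Finset.sum_congr rfl fun j _ => ?_
  rw [Finset.sum_congr rfl (g := fun _ => f j) (by simp +contextual)]
  simp

/-- The information density is concentrated: when the interference `v` obeys the allocation `Q`,
it falls short of the capacity of the Gaussian channel by `a` with probability `O(n / a ^ 2)`. -/
theorem measure_infoDensity_le {J : Type*} [Fintype J] [DecidableEq J] (b Q : J → ℝ)
    (hQ : ∀ j, 0 ≤ Q j) :
    ∃ K : ℝ, 0 ≤ K ∧ ∀ (n : ℕ) (φ : Fin n → J) (v : Fin n → ℝ) (a : ℝ), 0 < a →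
      (∀ j, ∑ t with φ t = j, v t ^ 2 ≤ ((Finset.univ.filter fun t => φ t = j).card : ℝ) * Q j) →
      ((noiseLaw n).prod (noiseLaw n)) {q | ∑ t, infoDensity (b (φ t)) (1 + Q (φ t)) (q.1 t)
          (b (φ t) * q.1 t + v t + q.2 t) ≤
        ∑ t, Real.log (1 + b (φ t) ^ 2 / (1 + Q (φ t))) / 2 - a} ≤
      ENNReal.ofReal (K * n / a ^ 2) := by
  set G : Measure ℝ := gaussianReal 0 1 with hG
  set N : J → ℝ := fun j => 1 + Q j with hNdef
  have hN : ∀ j, 0 < N j := fun j => by have := hQ j; simp only [N]; positivity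
  have hD : ∀ j, 0 < N j + b j ^ 2 := fun j => by have := hN j; positivity
  -- With output `b g + v + z`, the density is `α + v β - A v²`, where `A = 1 / (2 N) - 1 / (2 (N +
  -- b²)) ≥ 0`.
  set A : J → ℝ := fun j => b j ^ 2 / (2 * N j * (N j + b j ^ 2)) with hA
  set c : J → ℝ := fun j => Real.log (1 + b j ^ 2 / N j) / 2 with hc
  set α : J → ℝ × ℝ → ℝ := fun j q => c j - A j * q.2 ^ 2 + b j ^ 2 / (2 * (N j + b j ^ 2)) * q.1 ^ 2
    + b j / (N j + b j ^ 2) * (q.1 * q.2) with hα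
  set β : J → ℝ × ℝ → ℝ := fun j q => b j / (N j + b j ^ 2) * q.1 - 2 * A j * q.2 with hβ
  have m1 : MemLp (fun q : ℝ × ℝ => q.1) 2 (G.prod G) :=
    (memLp_id_gaussianReal' 2 (by simp) : MemLp (fun x : ℝ => x) 2 G).comp_fst G
  have m2 : MemLp (fun q : ℝ × ℝ => q.2) 2 (G.prod G) :=
    (memLp_id_gaussianReal' 2 (by simp) : MemLp (fun x : ℝ => x) 2 G).comp_snd G
  have m11 : MemLp (fun q : ℝ × ℝ => q.1 ^ 2) 2 (G.prod G) := memLp_sq_gaussianReal.comp_fst G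
  have m22 : MemLp (fun q : ℝ × ℝ => q.2 ^ 2) 2 (G.prod G) := memLp_sq_gaussianReal.comp_snd G
  have m12 : MemLp (fun q : ℝ × ℝ => q.1 * q.2) 2 (G.prod G) := memLp_mul_gaussianReal_prod
  have i1 : ∫ q, q.1 ∂(G.prod G) = 0 := by
    rw [integral_fun_fst (f := fun x : ℝ => x)]; simp [hG]
  have i2 : ∫ q, q.2 ∂(G.prod G) = 0 := by
    rw [integral_fun_snd (f := fun x : ℝ => x)]; simp [hG]
  have i11 : ∫ q, q.1 ^ 2 ∂(G.prod G) = 1 := by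
    rw [integral_fun_fst (f := fun x : ℝ => x ^ 2)]; simp [hG, integral_sq_gaussianReal]
  have i22 : ∫ q, q.2 ^ 2 ∂(G.prod G) = 1 := by
    rw [integral_fun_snd (f := fun x : ℝ => x ^ 2)]; simp [hG, integral_sq_gaussianReal]
  have i12 : ∫ q, q.1 * q.2 ∂(G.prod G) = 0 := by
    rw [integral_prod_mul (fun x : ℝ => x) (fun x : ℝ => x)]; simp [hG]
  have hα2 : ∀ j, MemLp (α j) 2 (G.prod G) := fun j =>
    (((memLp_const (c j)).sub (m22.const_mul _)).add (m11.const_mul _)).add (m12.const_mul _)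
  have hβ2 : ∀ j, MemLp (β j) 2 (G.prod G) := fun j => (m1.const_mul _).sub (m2.const_mul _)
  have le12 : (1 : ENNReal) ≤ 2 := by norm_num
  have hβ0 : ∀ j, ∫ q, β j q ∂(G.prod G) = 0 := by
    intro j
    rw [integral_sub ((m1.integrable le12).const_mul _) ((m2.integrable le12).const_mul _),
      integral_const_mul, integral_const_mul, i1, i2]
    simp
  -- The surplus `A Q` over the capacity `c` pays for the loss `A v²` of an interference that obeys
  -- its allowance. In this sense Gaussian interference is the worst.
  have hα0 : ∀ j, ∫ q, α j q ∂(G.prod G) = c j + A j * Q j := by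
    intro j
    have k1 := (m22.integrable le12).const_mul (A j)
    have k2 := (m11.integrable le12).const_mul (b j ^ 2 / (2 * (N j + b j ^ 2)))
    have k3 := (m12.integrable le12).const_mul (b j / (N j + b j ^ 2))
    have k0 : Integrable (fun _ : ℝ × ℝ => c j) (G.prod G) := integrable_const _
    have e1 := integral_add ((k0.sub k1).add k2) k3
    have e2 := integral_add (k0.sub k1) k2
    have e3 := integral_sub k0 k1
    simp only [Pi.add_apply, Pi.sub_apply] at e1 e2 e3
    rw [e1, e2, e3, integral_const_mul, integral_const_mul, integral_const_mul, i11, i22, i12]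
    have hQN : Q j = N j - 1 := by simp [N]
    have := hN j
    have := hD j
    simp only [integral_const, probReal_univ, smul_eq_mul, hA, hQN]
    field_simp
    ring
  obtain ⟨K, hK, hcheb⟩ := measure_sum_le_of_memLp (G.prod G) α β hα2 hβ2 hβ0
  refine ⟨K * (1 + ∑ j, Q j), mul_nonneg hK (add_nonneg zero_le_one
    (Finset.sum_nonneg fun j _ => hQ j)), fun n φ v a ha hv => ?_⟩
  have hmp := measurePreserving_arrowProdEquivProdArrow ℝ ℝ (Fin n) (fun _ => G) (fun _ => G)
  have hvQ : ∀ f : J → ℝ, (∀ j, 0 ≤ f j) → ∑ t, f (φ t) * v t ^ 2 ≤ ∑ t, f (φ t) * Q (φ t) := by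
    intro f hf
    rw [sum_comp_eq_sum_card φ (fun j => f j * Q j), ← Finset.sum_fiberwise Finset.univ φ]
    refine Finset.sum_le_sum fun j _ => ?_
    calc ∑ t with φ t = j, f (φ t) * v t ^ 2 = f j * ∑ t with φ t = j, v t ^ 2 := by
          rw [Finset.mul_sum]
          exact Finset.sum_congr rfl (by simp +contextual)
      _ ≤ f j * (_ * Q j) := mul_le_mul_of_nonneg_left (hv j) (hf j)
      _ = _ := by ring
  have hsum : ∑ t, (1 + v t ^ 2) ≤ n * (1 + ∑ j, Q j) := by
    have h1 := hvQ (fun _ => 1) (fun _ => zero_le_one)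
    simp only [one_mul] at h1
    have h2 : ∑ t, Q (φ t) ≤ ∑ _t : Fin n, ∑ j, Q j := Finset.sum_le_sum fun t _ =>
      Finset.single_le_sum (fun j _ => hQ j) (Finset.mem_univ _)
    rw [Finset.sum_add_distrib]
    simp only [Finset.sum_const, Finset.card_univ, Fintype.card_fin, nsmul_eq_mul] at h2 ⊢
    linarith
  have hms : MeasurableSet {q : (Fin n → ℝ) × (Fin n → ℝ) |
      ∑ t, infoDensity (b (φ t)) (1 + Q (φ t)) (q.1 t) (b (φ t) * q.1 t + v t + q.2 t) ≤
        ∑ t, Real.log (1 + b (φ t) ^ 2 / (1 + Q (φ t))) / 2 - a} := by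
    refine measurableSet_le ?_ measurable_const
    unfold infoDensity
    fun_prop
  change ((Measure.pi fun _ => G).prod (Measure.pi fun _ => G)) _ ≤ _
  rw [← hmp.measure_preimage hms.nullMeasurableSet]
  refine le_trans (measure_mono ?_) ((hcheb n φ v a ha).trans (ENNReal.ofReal_le_ofReal ?_))
  · intro ω hω
    have hω' : ∑ t, infoDensity (b (φ t)) (N (φ t)) (ω t).1 (b (φ t) * (ω t).1 + v t + (ω t).2) ≤
        ∑ t, c (φ t) - a := hω
    have hid : ∀ t, infoDensity (b (φ t)) (N (φ t)) (ω t).1 (b (φ t) * (ω t).1 + v t + (ω t).2) =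
        α (φ t) (ω t) + v t * β (φ t) (ω t) - A (φ t) * v t ^ 2 := by
      intro t
      have := hN (φ t)
      have := hD (φ t)
      simp only [infoDensity, hα, hβ, hA, hc]
      field_simp
      ring
    simp only [Set.mem_ofPred_eq, hα0]
    rw [Finset.sum_congr rfl fun t _ => hid t, Finset.sum_sub_distrib] at hω'
    have := hvQ A (fun j => by have := hN j; have := hD j; simp only [hA]; positivity)
    rw [Finset.sum_add_distrib (f := fun t => c (φ t))]
    linarith
  · refine div_le_div_of_nonneg_right ?_ (sq_nonneg a)
    calc K * ∑ t, (1 + v t ^ 2) ≤ K * (n * (1 + ∑ j, Q j)) := by gcongr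
      _ = _ := by ring

/-! ### Power of Gaussian codewords. -/

/-- A standard Gaussian vector, slightly scaled down, obeys the power constraints of all phases
with a probability that tends to one. -/
theorem eventually_measure_power_le {J : Type*} [Fintype J] [DecidableEq J] (lam : J → ℝ)
    (hlam : ∀ j, 0 < lam j) {η : ℝ} (hη : 0 < η) {ε : ℝ} (hε : 0 < ε) :
    ∀ᶠ n : ℕ in atTop, ∀ φ : Fin n → J,
      (∀ j, n * lam j - 1 ≤ (Finset.univ.filter fun t => φ t = j).card) →
      noiseLaw n {g | ∀ j, (1 - η) * ∑ t with φ t = j, g t ^ 2 ≤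
        (Finset.univ.filter fun t => φ t = j).card}ᶜ ≤ ENNReal.ofReal ε := by
  have hK : ∀ j : J, ∃ K : ℝ, 0 ≤ K ∧ ∀ (n : ℕ) (φ : Fin n → J) (a : ℝ), 0 < a →
      noiseLaw n {g | ((Finset.univ.filter fun t => φ t = j).card : ℝ) + a ≤
        ∑ t with φ t = j, g t ^ 2} ≤ ENNReal.ofReal (K * n / a ^ 2) := by
    intro j
    -- The sign of `-x²` turns the lower tail bound into the upper tail bound for the energy in
    -- phase `j`.
    obtain ⟨K, hK, h⟩ := measure_sum_le_of_memLp (gaussianReal 0 1)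
      (fun i : J => fun x : ℝ => if i = j then - x ^ 2 else 0) (fun _ _ => 0)
      (fun i => by
        by_cases hi : i = j
        · simp only [hi, if_true]
          exact memLp_sq_gaussianReal.neg
        · simp [hi])
      (fun _ => by simp) (fun _ => by simp)
    refine ⟨K, hK, fun n φ a ha => ?_⟩
    have h1 := h n φ 0 a ha
    simp only [Pi.zero_apply, zero_mul, add_zero, ne_eq, OfNat.ofNat_ne_zero, not_false_eq_true,
      zero_pow, Finset.sum_const, Finset.card_univ, Fintype.card_fin, nsmul_eq_mul, mul_one] at h1
    refine le_trans (measure_mono ?_) h1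
    intro g hg
    simp only [Set.mem_ofPred_eq] at hg ⊢
    have e1 : ∑ t, ∫ x, (if φ t = j then -x ^ 2 else 0) ∂(gaussianReal 0 1) =
        - (Finset.univ.filter fun t => φ t = j).card := by
      have : ∀ t, ∫ x, (if φ t = j then -x ^ 2 else 0) ∂(gaussianReal 0 1) =
          if φ t = j then (-1 : ℝ) else 0 := by
        intro t
        split_ifs
        · rw [integral_neg, integral_sq_gaussianReal]
        · simp
      simp_rw [this]
      rw [← Finset.sum_filter]
      simp
    rw [e1, ← Finset.sum_filter, Finset.sum_neg_distrib]
    linarith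
  choose K hK0 hK using hK
  have htend : Tendsto (fun n : ℕ => (∑ j, K j * 4 / (η ^ 2 * lam j ^ 2)) / (n : ℝ)) atTop (𝓝 0) :=
    tendsto_const_div_atTop_nhds_zero_nat _
  have hlarge : ∀ᶠ n : ℕ in atTop, ∀ j, 2 / lam j ≤ (n : ℝ) := by
    rw [eventually_all]
    exact fun j => tendsto_natCast_atTop_atTop.eventually_ge_atTop _
  filter_upwards [htend.eventually_le_const hε, hlarge, eventually_gt_atTop 0] with n hn hl hn0 φ hφ
  have hn0' : (0 : ℝ) < n := by exact_mod_cast hn0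
  have hcard : ∀ j, n * lam j / 2 ≤ ((Finset.univ.filter fun t => φ t = j).card : ℝ) := by
    intro j
    have h1 := hl j
    rw [div_le_iff₀ (hlam j)] at h1
    linarith [hφ j]
  have hpos : ∀ j, 0 < n * lam j / 2 := fun j => by have := hlam j; positivity
  calc noiseLaw n {g | ∀ j, (1 - η) * ∑ t with φ t = j, g t ^ 2 ≤
        (Finset.univ.filter fun t => φ t = j).card}ᶜ
      ≤ noiseLaw n (⋃ j ∈ (Finset.univ : Finset J),
          {g | ((Finset.univ.filter fun t => φ t = j).card : ℝ) + η * (n * lam j / 2) ≤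
            ∑ t with φ t = j, g t ^ 2}) := by
        refine measure_mono fun g hg => ?_
        simp only [Set.mem_compl_iff, Set.mem_ofPred_eq, not_forall, not_le] at hg
        obtain ⟨j, hj⟩ := hg
        simp only [Set.mem_iUnion, Finset.mem_univ, Set.mem_ofPred_eq, exists_true_left]
        refine ⟨j, ?_⟩
        have hS : 0 ≤ ∑ t with φ t = j, g t ^ 2 := Finset.sum_nonneg fun t _ => sq_nonneg _
        set S := ∑ t with φ t = j, g t ^ 2
        set m := ((Finset.univ.filter fun t => φ t = j).card : ℝ)
        have h1 := hcard j
        have h2 := hpos j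
        -- From `m < (1 - η) S` follows `S > m + η S ≥ m + η m`, and `m ≥ n lam / 2`.
        have h3 : η * (n * lam j / 2) ≤ η * m := by gcongr
        have h4 : m ≤ S := by nlinarith
        nlinarith
    _ ≤ ∑ j, noiseLaw n {g | ((Finset.univ.filter fun t => φ t = j).card : ℝ) +
          η * (n * lam j / 2) ≤ ∑ t with φ t = j, g t ^ 2} := measure_biUnion_finset_le _ _
    _ ≤ ∑ j, ENNReal.ofReal (K j * n / (η * (n * lam j / 2)) ^ 2) := by
        refine Finset.sum_le_sum fun j _ => hK j n φ _ (mul_pos hη (hpos j))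
    _ = ENNReal.ofReal (∑ j, K j * n / (η * (n * lam j / 2)) ^ 2) := by
        rw [ENNReal.ofReal_sum_of_nonneg]
        intro j _
        have := hK0 j
        positivity
    _ ≤ ENNReal.ofReal ε := by
        refine ENNReal.ofReal_le_ofReal (le_trans (le_of_eq ?_) hn)
        rw [Finset.sum_div]
        refine Finset.sum_congr rfl fun j _ => ?_
        have := hlam j
        field_simp
        ring

/-! ### Numbers of messages and uniform laws. -/

theorem numIdx_pos {R : ℝ} (hR : 0 ≤ R) (n : ℕ) : 0 < numIdx R n :=
  Nat.floor_pos.2 (Real.one_le_rpow one_le_two (by positivity))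

theorem numIdx_zero_left (n : ℕ) : numIdx 0 n = 1 := by simp [numIdx]

theorem numIdx_zero_right (R : ℝ) : numIdx R 0 = 1 := by simp [numIdx]

theorem numIdx_mono {R R' : ℝ} (h : R ≤ R') (n : ℕ) : numIdx R n ≤ numIdx R' n :=
  Nat.floor_mono (Real.rpow_le_rpow_of_exponent_le one_le_two (by gcongr))

theorem numIdx_le_exp (R : ℝ) (n : ℕ) : (numIdx R n : ℝ) ≤ Real.exp (n * (R * Real.log 2)) := by
  refine (Nat.floor_le (by positivity)).trans (le_of_eq ?_)
  rw [Real.rpow_def_of_pos two_pos]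
  congr 1
  ring

instance isProbabilityMeasure_noiseLaw (n : ℕ) : IsProbabilityMeasure (noiseLaw n) := by
  unfold noiseLaw
  infer_instance

theorem isProbabilityMeasure_uniformOn_fin {M : ℕ} (hM : 0 < M) :
    IsProbabilityMeasure (uniformOn (Set.univ : Set (Fin M))) :=
  isProbabilityMeasure_uniformOn Set.finite_univ ⟨⟨0, hM⟩, trivial⟩

theorem uniformOn_univ_prod_apply {M : ℕ} {U : Type*} [MeasurableSpace U] (κ : Measure U)
    [IsProbabilityMeasure κ] {s : Set (Fin M × U)} (hs : MeasurableSet s) :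
    ((uniformOn (Set.univ : Set (Fin M))).prod κ) s = (M : ENNReal)⁻¹ * ∑ w, κ {u | (w, u) ∈ s} := by
  rw [Measure.prod_apply hs, uniformOn, ProbabilityTheory.cond, Measure.restrict_univ, lintegral_smul_measure,
    lintegral_count, tsum_fintype]
  simp only [Measure.count_univ, ENat.card_eq_coe_fintype_card, Fintype.card_fin, smul_eq_mul]
  rfl

/-! ### Coding theorem for the Gaussian channel with interference. -/

/-- Rates strictly below the capacity stay below it for a slightly smaller input power. -/
theorem exists_power_backoff {J : Type*} [Fintype J] (lam P N : J → ℝ) (h : ℝ)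
    (hP : ∀ j, 0 ≤ P j) (hN : ∀ j, 0 < N j) {r : ℝ}
    (hr : r < ∑ j, lam j * (Real.log (1 + h ^ 2 * P j / N j) / 2)) :
    ∃ η : ℝ, 0 < η ∧ η < 1 ∧
      r < ∑ j, lam j * (Real.log (1 + h ^ 2 * ((1 - η) * P j) / N j) / 2) := by
  have hcont : ContinuousAt
      (fun η : ℝ => ∑ j, lam j * (Real.log (1 + h ^ 2 * ((1 - η) * P j) / N j) / 2)) 0 := by
    refine tendsto_finsetSum _ fun j _ => ?_
    have h1 : ContinuousAt (fun η : ℝ => 1 + h ^ 2 * ((1 - η) * P j) / N j) 0 := by fun_prop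
    have h2 : (1 + h ^ 2 * ((1 - (0 : ℝ)) * P j) / N j) ≠ 0 := by
      have := hP j
      have := hN j
      simp only [sub_zero, one_mul]
      positivity
    exact ((h1.log h2).div_const 2).const_mul (lam j)
  have h0 : r < ∑ j, lam j * (Real.log (1 + h ^ 2 * ((1 - (0 : ℝ)) * P j) / N j) / 2) := by
    simpa using hr
  have hev := (hcont.tendsto.eventually_const_lt h0)
  have hev' : ∀ᶠ η in 𝓝[>] (0 : ℝ), η ∈ Set.Ioo (0 : ℝ) 1 ∧
      r < ∑ j, lam j * (Real.log (1 + h ^ 2 * ((1 - η) * P j) / N j) / 2) :=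
    Filter.Eventually.and (Ioo_mem_nhdsGT zero_lt_one) (hev.filter_mono nhdsWithin_le_nhds)
  obtain ⟨η, ⟨h1, h2⟩, h3⟩ := hev'.exists
  exact ⟨η, h1, h2, h3⟩

/-- **Coding theorem for the Gaussian channel with interference.** At rates below the capacity of
the channel with gain `h` and Gaussian noise of power `1 + Q j` in the phase `j` of the block,
there is a codebook that obeys the power allocation `P` and for which the weighted minimum distance
decoder is reliable under every interference `v` that obeys the power allocation `Q`. -/
theorem eventually_exists_codebook {J : Type*} [Fintype J] [DecidableEq J] (lam P Q : J → ℝ) (h : ℝ)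
    (hlam : ∀ j, 0 < lam j) (hP : ∀ j, 0 ≤ P j) (hQ : ∀ j, 0 ≤ Q j) {R : ℝ}
    (hR : R = 0 ∨
      R * Real.log 2 < ∑ j, lam j * (Real.log (1 + h ^ 2 * P j / (1 + Q j)) / 2))
    {ε : ℝ} (hε : 0 < ε) :
    ∀ᶠ n : ℕ in atTop, ∀ φ : Fin n → J,
      (∀ j, n * lam j - 1 ≤ (Finset.univ.filter fun t => φ t = j).card) →
      ∀ (S : Type) [MeasurableSpace S] (κ : Measure S) [IsProbabilityMeasure κ]
        (v : S → Fin n → ℝ), Measurable v →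
        (∀ s j, ∑ t with φ t = j, v s t ^ 2 ≤
          ((Finset.univ.filter fun t => φ t = j).card : ℝ) * Q j) →
      ∃ x : Fin (numIdx R n) → Fin n → ℝ,
        (∀ w j, ∑ t with φ t = j, x w t ^ 2 ≤
          ((Finset.univ.filter fun t => φ t = j).card : ℝ) * P j) ∧
        ∀ d : (Fin n → ℝ) → Fin (numIdx R n), Measurable d →
          (∀ y w, ∑ t, (y t - h * x (d y) t) ^ 2 / (1 + Q (φ t)) ≤
            ∑ t, (y t - h * x w t) ^ 2 / (1 + Q (φ t))) →
          ((uniformOn (Set.univ : Set (Fin (numIdx R n)))).prod (κ.prod (noiseLaw n)))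
            {q | d (fun t => h * x q.1 t + v q.2.1 t + q.2.2 t) ≠ q.1} ≤ ENNReal.ofReal ε := by
  -- At rate zero there is a single message and no error is possible. This case is separate because
  -- the capacity may be zero.
  rcases hR with rfl | hR
  · refine Eventually.of_forall fun n φ _ S _ κ _ v _ _ => ⟨fun _ _ => 0, ?_, ?_⟩
    · intro w j
      have := hP j
      simp only [ne_eq, OfNat.ofNat_ne_zero, not_false_eq_true, zero_pow, Finset.sum_const_zero]
      positivity
    · intro d _ _
      have hsub : ∀ a b : Fin (numIdx 0 n), a = b := by
        rw [numIdx_zero_left]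
        exact fun a b => Subsingleton.elim a b
      have : {q : Fin (numIdx 0 n) × S × (Fin n → ℝ) |
          d (fun t => h * 0 + v q.2.1 t + q.2.2 t) ≠ q.1} = ∅ :=
        Set.eq_empty_of_forall_notMem fun q hq => hq (hsub _ _)
      rw [this, measure_empty]
      exact zero_le
  have hN : ∀ j, 0 < 1 + Q j := fun j => by have := hQ j; positivity
  obtain ⟨η, hη0, hη1, hη⟩ := exists_power_backoff lam P (fun j => 1 + Q j) h hP hN hR
  set σ : J → ℝ := fun j => √((1 - η) * P j) with hσ
  have hσ2 : ∀ j, σ j ^ 2 = (1 - η) * P j := fun j =>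
    Real.sq_sqrt (mul_nonneg (by linarith) (hP j))
  set b : J → ℝ := fun j => h * σ j with hb
  have hb2 : ∀ j, b j ^ 2 = h ^ 2 * ((1 - η) * P j) := fun j => by rw [hb, mul_pow, hσ2]
  set c : J → ℝ := fun j => Real.log (1 + b j ^ 2 / (1 + Q j)) / 2 with hc
  have hc0 : ∀ j, 0 ≤ c j := fun j => by
    have := hN j
    exact div_nonneg (Real.log_nonneg (by simp; positivity)) two_pos.le
  have hη' : R * Real.log 2 < ∑ j, lam j * c j := by
    simpa only [hc, hb2] using hη
  -- One third of the gap each for the union bound over rivals, for the concentration of the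
  -- density, and for the rounding of the phases.
  set δ : ℝ := (∑ j, lam j * c j - R * Real.log 2) / 3 with hδ
  have hδ0 : 0 < δ := by rw [hδ]; linarith
  obtain ⟨K, hK0, hK⟩ := measure_infoDensity_le b Q hQ
  have ht1 : Tendsto (fun n : ℕ => (2 * K / δ ^ 2) / (n : ℝ) + 2 * Real.exp (- (n * δ)))
      atTop (𝓝 0) := by
    have h1 := tendsto_const_div_atTop_nhds_zero_nat (2 * K / δ ^ 2)
    have h2 : Tendsto (fun n : ℕ => (n : ℝ) * δ) atTop atTop :=
      tendsto_natCast_atTop_atTop.atTop_mul_const hδ0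
    have h3 := (Real.tendsto_exp_neg_atTop_nhds_zero.comp h2).const_mul 2
    simpa using h1.add h3
  have hlarge : ∀ᶠ n : ℕ in atTop, (∑ j, c j) / δ ≤ n :=
    tendsto_natCast_atTop_atTop.eventually_ge_atTop _
  filter_upwards [ht1.eventually_le_const hε, hlarge, eventually_gt_atTop 0,
    eventually_measure_power_le lam hlam hη0 (ε := 1 / 2) (by norm_num)] with n hn hl hn0 hA
  intro φ hφ S _ κ _ v hvm hv
  have hn0' : (0 : ℝ) < n := by exact_mod_cast hn0
  set A : Set (Fin n → ℝ) := {g | ∀ j, (1 - η) * ∑ t with φ t = j, g t ^ 2 ≤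
    (Finset.univ.filter fun t => φ t = j).card} with hAdef
  have hAm : MeasurableSet A := by
    rw [hAdef, Set.ofPred_forall]
    exact MeasurableSet.iInter fun j => measurableSet_le (by fun_prop) measurable_const
  have hAhalf : (2 : ENNReal)⁻¹ ≤ noiseLaw n A := by
    have h1 := hA φ hφ
    rw [prob_compl_eq_one_sub hAm] at h1
    have h2 : ENNReal.ofReal (1 / 2) = 2⁻¹ := by
      rw [one_div, ENNReal.ofReal_inv_of_pos two_pos]
      simp
    rw [h2, tsub_le_iff_right] at h1
    have h3 : (2 : ENNReal)⁻¹ + 2⁻¹ ≤ 2⁻¹ + noiseLaw n A := by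
      rwa [ENNReal.inv_two_add_inv_two]
    exact (ENNReal.add_le_add_iff_left (by simp)).1 h3
  -- Conditioning on `A` enforces the power constraints. As `A` has probability at least one half,
  -- it costs a factor 2 in the estimates.
  set μ : Measure (Fin n → ℝ) := cond (noiseLaw n) A with hμ
  have hA0 : noiseLaw n A ≠ 0 := fun h0 => by simp [h0] at hAhalf
  have : IsProbabilityMeasure μ := cond_isProbabilityMeasure hA0
  have hμle : μ ≤ (2 : ENNReal) • noiseLaw n := by
    rw [hμ, ProbabilityTheory.cond]
    calc (noiseLaw n A)⁻¹ • (noiseLaw n).restrict A ≤ (noiseLaw n A)⁻¹ • noiseLaw n := by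
          gcongr
          exact Measure.restrict_le_self
      _ ≤ _ := by
          gcongr
          exact ENNReal.inv_le_iff_inv_le.1 hAhalf
  obtain ⟨F, hFdef⟩ : ∃ F : (Fin n → ℝ) → (Fin n → ℝ) → ENNReal, F = fun g y =>
    ENNReal.ofReal (Real.exp (∑ t, infoDensity (b (φ t)) (1 + Q (φ t)) (g t) (y t))) := ⟨_, rfl⟩
  have hFm : Measurable (Function.uncurry F) := by
    simp only [hFdef, infoDensity, Function.uncurry_def]
    fun_prop
  have hFC : ∀ y, ∫⁻ g, F g y ∂μ ≤ 2 := by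
    intro y
    calc ∫⁻ g, F g y ∂μ ≤ ∫⁻ g, F g y ∂((2 : ENNReal) • noiseLaw n) := lintegral_mono' hμle le_rfl
      _ = 2 := by
        simp only [hFdef]
        rw [lintegral_smul_measure, lintegral_exp_sum_infoDensity _ _ _ fun t => hN (φ t)]
        simp
  obtain ⟨f, hf⟩ : ∃ f : (Fin n → ℝ) → S × (Fin n → ℝ) → Fin n → ℝ, f = fun g u t =>
    b (φ t) * g t + v u.1 t + u.2 t := ⟨_, rfl⟩
  have hfm : Measurable (Function.uncurry f) := by
    simp only [hf, Function.uncurry_def]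
    fun_prop
  set L : ℝ := n * (R * Real.log 2 + δ) with hL
  set γ : ENNReal := ENNReal.ofReal (Real.exp L) with hγ
  have hγ0 : γ ≠ 0 := by simp [hγ, Real.exp_pos]
  have hγt : γ ≠ ⊤ := ENNReal.ofReal_ne_top
  have hpA : ∀ᵐ g ∂μ, g ∈ A := by
    rw [hμ, ProbabilityTheory.cond]
    exact Measure.ae_smul_measure (ae_restrict_mem hAm) _
  obtain ⟨g, hgA, hg⟩ := exists_codebook μ (κ.prod (noiseLaw n)) f hfm F hFm 2 γ hγ0 hγt hFC
    (· ∈ A) hpA (numIdx R n)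
  have hcap : L ≤ ∑ t, c (φ t) - n * δ := by
    have h1 : ∑ j, (n * lam j - 1) * c j ≤ ∑ t, c (φ t) := by
      rw [sum_comp_eq_sum_card]
      exact Finset.sum_le_sum fun j _ => mul_le_mul_of_nonneg_right (hφ j) (hc0 j)
    have h2 : ∑ j, (n * lam j - 1) * c j = n * ∑ j, lam j * c j - ∑ j, c j := by
      rw [Finset.mul_sum, ← Finset.sum_sub_distrib]
      exact Finset.sum_congr rfl fun j _ => by ring
    rw [div_le_iff₀ hδ0] at hl
    have h3 : (∑ j, lam j * c j) = R * Real.log 2 + 3 * δ := by rw [hδ]; ring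
    rw [h2, h3] at h1
    rw [hL]
    linarith
  have hFfm : Measurable fun q : (Fin n → ℝ) × S × (Fin n → ℝ) => F q.1 (f q.1 q.2) := by
    have h1 : Measurable fun q : (Fin n → ℝ) × S × (Fin n → ℝ) => (q.1, f q.1 q.2) :=
      measurable_fst.prodMk hfm
    exact hFm.comp h1
  have htyp : (μ.prod (κ.prod (noiseLaw n))) {q | F q.1 (f q.1 q.2) < γ} ≤
      ENNReal.ofReal ((2 * K / δ ^ 2) / (n : ℝ)) := by
    have hms : MeasurableSet {q : (Fin n → ℝ) × S × (Fin n → ℝ) | F q.1 (f q.1 q.2) < γ} :=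
      measurableSet_lt hFfm measurable_const
    rw [Measure.prod_apply_symm hms]
    have hms1 : ∀ s, MeasurableSet {q : (Fin n → ℝ) × (Fin n → ℝ) | F q.1 (f q.1 (s, q.2)) < γ} := by
      intro s
      refine hms.preimage (f := fun q : (Fin n → ℝ) × (Fin n → ℝ) => (q.1, s, q.2)) ?_
      exact measurable_fst.prodMk (measurable_const.prodMk measurable_snd)
    calc ∫⁻ u, μ ((fun g => (g, u)) ⁻¹' {q | F q.1 (f q.1 q.2) < γ}) ∂(κ.prod (noiseLaw n))
        ≤ ∫⁻ u, 2 * noiseLaw n ((fun g => (g, u)) ⁻¹' {q | F q.1 (f q.1 q.2) < γ})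
            ∂(κ.prod (noiseLaw n)) := by
          refine lintegral_mono fun u => ?_
          simpa using hμle _
      _ = 2 * ∫⁻ s, ((noiseLaw n).prod (noiseLaw n))
            {q | F q.1 (f q.1 (s, q.2)) < γ} ∂κ := by
          rw [lintegral_const_mul _ (measurable_measure_prodMk_right hms),
            lintegral_prod _ (measurable_measure_prodMk_right hms).aemeasurable]
          congr 1
          refine lintegral_congr fun s => ?_
          rw [Measure.prod_apply_symm (hms1 s)]
          rfl
      _ ≤ 2 * ∫⁻ _, ENNReal.ofReal (K * n / (n * δ) ^ 2) ∂κ := by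
          -- The constant `K` is the same for all interferences, so the bound holds for each `s`
          -- separately.
          gcongr with s
          refine (measure_mono ?_).trans (hK n φ (v s) (n * δ) (by positivity) (hv s))
          intro q hq
          simp only [hFdef, hf, Set.mem_ofPred_eq] at hq
          have hq' : Real.exp (∑ t, infoDensity (b (φ t)) (1 + Q (φ t)) (q.1 t)
              (b (φ t) * q.1 t + v s t + q.2 t)) < Real.exp L :=
            (ENNReal.ofReal_lt_ofReal_iff (Real.exp_pos _)).1 hq
          exact ((Real.exp_lt_exp.1 hq').le).trans hcap
      _ = ENNReal.ofReal ((2 * K / δ ^ 2) / (n : ℝ)) := by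
          rw [lintegral_const, measure_univ, mul_one,
            show (2 : ENNReal) = ENNReal.ofReal 2 by simp, ← ENNReal.ofReal_mul zero_le_two]
          congr 1
          field_simp
  have hunion : (numIdx R n : ENNReal) * (2 / γ) ≤ ENNReal.ofReal (2 * Real.exp (- (n * δ))) := by
    have h1 : (numIdx R n : ENNReal) ≤ ENNReal.ofReal (Real.exp (n * (R * Real.log 2))) := by
      rw [← ENNReal.ofReal_natCast]
      exact ENNReal.ofReal_le_ofReal (numIdx_le_exp R n)
    calc (numIdx R n : ENNReal) * (2 / γ)
        ≤ ENNReal.ofReal (Real.exp (n * (R * Real.log 2))) * (2 / γ) := by gcongr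
      _ = ENNReal.ofReal (2 * Real.exp (- (n * δ))) := by
          rw [hγ, show (2 : ENNReal) = ENNReal.ofReal 2 by simp,
            ← ENNReal.ofReal_div_of_pos (Real.exp_pos _), ← ENNReal.ofReal_mul (Real.exp_pos _).le]
          congr 1
          rw [mul_div_assoc', div_eq_iff (Real.exp_pos _).ne', mul_comm (Real.exp _) 2, mul_assoc,
            ← Real.exp_add, hL]
          congr 2
          ring
  refine ⟨fun w t => σ (φ t) * g w t, ?_, ?_⟩
  · intro w j
    have h1 := hgA w j
    calc ∑ t with φ t = j, (σ (φ t) * g w t) ^ 2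
        = P j * ((1 - η) * ∑ t with φ t = j, g w t ^ 2) := by
          rw [← mul_assoc, Finset.mul_sum]
          refine Finset.sum_congr rfl fun t ht => ?_
          rw [mul_pow, hσ2, (Finset.mem_filter.1 ht).2]
          ring
      _ ≤ P j * (Finset.univ.filter fun t => φ t = j).card := by
          have := hP j
          gcongr
      _ = _ := mul_comm _ _
  · intro d hdm hd
    have hout : ∀ w u, (fun t => h * (σ (φ t) * g w t) + v u.1 t + u.2 t) = f (g w) u := by
      intro w u
      ext t
      simp only [hf, hb]
      ring
    have hms : MeasurableSet {q : Fin (numIdx R n) × S × (Fin n → ℝ) |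
        d (fun t => h * (σ (φ t) * g q.1 t) + v q.2.1 t + q.2.2 t) ≠ q.1} := by
      have hgm : Measurable g := measurable_of_countable g
      refine (measurableSet_eq_fun (hdm.comp ?_) measurable_fst).compl
      fun_prop
    rw [uniformOn_univ_prod_apply _ hms]
    have hM : (numIdx R n : ENNReal)⁻¹ * numIdx R n ≤ 1 := ENNReal.inv_mul_le_one _
    calc (numIdx R n : ENNReal)⁻¹ * ∑ w, (κ.prod (noiseLaw n)) {u | (w, u) ∈
          {q : Fin (numIdx R n) × S × (Fin n → ℝ) |
            d (fun t => h * (σ (φ t) * g q.1 t) + v q.2.1 t + q.2.2 t) ≠ q.1}}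
        ≤ (numIdx R n : ENNReal)⁻¹ * (numIdx R n *
            ((μ.prod (κ.prod (noiseLaw n))) {q | F q.1 (f q.1 q.2) < γ} +
              numIdx R n * (2 / γ))) := by
          gcongr
          refine le_trans (Finset.sum_le_sum fun w _ => measure_mono ?_) hg
          intro u hu
          simp only [Set.mem_ofPred_eq, hout] at hu
          -- Only the squared distance in the density depends on the codeword, so the minimum
          -- distance decoder maximizes `F`, and a wrong decision is a rival with at least the score
          -- of the true codeword.
          refine ⟨d (f (g w) u), hu, ?_⟩
          have h1 := hd (f (g w) u) w
          simp only [hFdef]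
          refine ENNReal.ofReal_le_ofReal (Real.exp_le_exp.2 ?_)
          simp only [infoDensity, Finset.sum_add_distrib, Finset.sum_sub_distrib]
          have h2 : ∀ w', ∑ t, (f (g w) u t - b (φ t) * g w' t) ^ 2 / (2 * (1 + Q (φ t))) =
              (∑ t, (f (g w) u t - h * (σ (φ t) * g w' t)) ^ 2 / (1 + Q (φ t))) / 2 := by
            intro w'
            rw [Finset.sum_div]
            refine Finset.sum_congr rfl fun t _ => ?_
            simp only [hb]
            rw [div_div, mul_comm 2, mul_assoc]
          rw [h2 w, h2 (d (f (g w) u))]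
          linarith
      _ ≤ 1 * (ENNReal.ofReal ((2 * K / δ ^ 2) / (n : ℝ)) +
            ENNReal.ofReal (2 * Real.exp (- (n * δ)))) := by
          rw [← mul_assoc]
          gcongr
      _ = ENNReal.ofReal ((2 * K / δ ^ 2) / (n : ℝ) + 2 * Real.exp (- (n * δ))) := by
          rw [one_mul, ENNReal.ofReal_add (by positivity) (by positivity)]
      _ ≤ ENNReal.ofReal ε := ENNReal.ofReal_le_ofReal hn

/-! ### The one-time pad. -/

/-- Removal of the key from an encrypted message. -/
def unpad {M N : ℕ} (s : Fin M) (k : Fin N) : Fin M :=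
  ⟨((s : ℕ) + (M - (k : ℕ) % M)) % M, Nat.mod_lt _ s.pos⟩

theorem pad_unpad {M N : ℕ} (s : Fin M) (k : Fin N) : pad (unpad s k) k = s := by
  have h1 : (k : ℕ) % M ≤ M := (Nat.mod_lt _ s.pos).le
  have h2 : (k : ℕ) % M + M * ((k : ℕ) / M) = k := Nat.mod_add_div _ _
  ext
  simp only [pad, unpad, Nat.mod_add_mod]
  have h3 : (s : ℕ) + (M - (k : ℕ) % M) + k = s + M * (1 + (k : ℕ) / M) := by
    rw [mul_add, mul_one]
    omega
  rw [h3, Nat.add_mul_mod_self_left, Nat.mod_eq_of_lt s.2]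

theorem pad_injective {M N : ℕ} (k : Fin N) : Function.Injective fun w : Fin M => pad w k :=
  (Finite.injective_iff_surjective).2 fun s => ⟨unpad s k, pad_unpad s k⟩

/-- Keys with the same effect on `w` are congruent modulo `M`, so their quotients by `M` tell them
apart. -/
theorem card_filter_pad_eq_le {M N : ℕ} (w s : Fin M) :
    (Finset.univ.filter fun k : Fin N => pad w k = s).card ≤ N / M + 1 := by
  rw [← Finset.card_range (N / M + 1)]
  refine Finset.card_le_card_of_injOn (fun k => (k : ℕ) / M) ?_ ?_
  · intro k _
    simp only [Finset.coe_range, Set.mem_Iio]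
    exact Nat.lt_succ_of_le (Nat.div_le_div_right k.2.le)
  · intro k hk k' hk' h
    simp only [Finset.coe_filter, Finset.mem_univ, true_and, Set.mem_ofPred_eq] at hk hk'
    have h1 : ((w : ℕ) + k) % M = ((w : ℕ) + k') % M := by
      have := hk.trans hk'.symm
      simpa [pad] using this
    have h2 : (k : ℕ) % M = (k' : ℕ) % M := Nat.ModEq.add_left_cancel' (w : ℕ) h1
    have h3 : (k : ℕ) / M = (k' : ℕ) / M := h
    ext
    rw [← Nat.mod_add_div (k : ℕ) M, ← Nat.mod_add_div (k' : ℕ) M, h2, h3]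

theorem Measure.le_of_forall_singleton_le {α : Type*} [MeasurableSpace α] [Countable α]
    [MeasurableSingletonClass α] {μ ν : Measure α} (h : ∀ a, μ {a} ≤ ν {a}) : μ ≤ ν := by
  refine Measure.le_iff.2 fun s hs => ?_
  rw [← Measure.tsum_indicator_apply_singleton μ s hs,
    ← Measure.tsum_indicator_apply_singleton ν s hs]
  exact ENNReal.tsum_le_tsum fun a => Set.indicator_le_indicator (h a)

theorem uniformOn_univ_fin_singleton {M : ℕ} (w : Fin M) :
    uniformOn (Set.univ : Set (Fin M)) {w} = (M : ENNReal)⁻¹ := by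
  rw [uniformOn_univ]
  simp

/-- The encrypted message is uniformly distributed. -/
theorem measurePreserving_pad {M N : ℕ} (hN : 0 < N) :
    MeasurePreserving (fun q : Fin M × Fin N => pad q.1 q.2)
      ((uniformOn Set.univ).prod (uniformOn Set.univ)) (uniformOn Set.univ) := by
  refine ⟨measurable_of_countable _, ?_⟩
  have := isProbabilityMeasure_uniformOn_fin hN
  refine Measure.ext_of_singleton fun s => ?_
  rw [Measure.map_apply (measurable_of_countable _) (measurableSet_singleton _),
    Measure.prod_apply_symm (Set.Finite.measurableSet (Set.toFinite _))]
  have h : ∀ k : Fin N, (fun w : Fin M => (w, k)) ⁻¹'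
      ((fun q : Fin M × Fin N => pad q.1 q.2) ⁻¹' {s}) = {unpad s k} := by
    intro k
    ext w
    simp only [Set.mem_preimage, Set.mem_singleton_iff]
    rw [← (pad_injective k).eq_iff (a := w), pad_unpad]
  simp_rw [h, uniformOn_univ_fin_singleton]
  simp

/-- If there are at least as many keys as messages, then the joint law of the message and the
encrypted message is dominated by twice the product law. -/
theorem map_prod_pad_le {M N : ℕ} (hM : 0 < M) (hMN : M ≤ N) :
    ((uniformOn Set.univ).prod (uniformOn Set.univ)).map
        (fun q : Fin M × Fin N => (q.1, pad q.1 q.2)) ≤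
      (2 : ENNReal) • (uniformOn (Set.univ : Set (Fin M))).prod
        (uniformOn (Set.univ : Set (Fin M))) := by
  have hN : 0 < N := hM.trans_le hMN
  have := isProbabilityMeasure_uniformOn_fin hN
  have := isProbabilityMeasure_uniformOn_fin hM
  refine Measure.le_of_forall_singleton_le fun ⟨w, s⟩ => ?_
  have h1 : (fun q : Fin M × Fin N => (q.1, pad q.1 q.2)) ⁻¹' {(w, s)} =
      {w} ×ˢ {k | pad w k = s} := by
    ext ⟨w', k⟩
    simp only [Set.mem_preimage, Set.mem_singleton_iff, Prod.mk.injEq, Set.mem_prod,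
      Set.mem_ofPred_eq]
    constructor
    · rintro ⟨rfl, h⟩; exact ⟨rfl, h⟩
    · rintro ⟨rfl, h⟩; exact ⟨rfl, h⟩
  have h2 : uniformOn (Set.univ : Set (Fin N)) {k | pad w k = s} ≤ 2 * (M : ENNReal)⁻¹ := by
    rw [uniformOn_univ, Fintype.card_fin]
    have h3 : Measure.count {k : Fin N | pad w k = s} =
        ((Finset.univ.filter fun k : Fin N => pad w k = s).card : ENNReal) := by
      rw [← Measure.count_apply_finset]
      congr 1
      ext k
      simp
    -- The term `+ 1` is due to `M` not dividing `N`; with `M ≤ N` it costs at most a factor 2.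
    have h4 : M * (Finset.univ.filter fun k : Fin N => pad w k = s).card ≤ 2 * N :=
      calc _ ≤ M * (N / M + 1) := Nat.mul_le_mul_left _ (card_filter_pad_eq_le w s)
        _ = M * (N / M) + M := by ring
        _ ≤ N + N := Nat.add_le_add (Nat.mul_div_le N M) hMN
        _ = 2 * N := by ring
    rw [h3, ENNReal.div_le_iff (by simpa using hN.ne') (by simp), mul_right_comm,
      ← div_eq_mul_inv, ENNReal.le_div_iff_mul_le (by simp [hM.ne']) (by simp), mul_comm]
    exact_mod_cast h4
  rw [Measure.map_apply (measurable_of_countable _) (measurableSet_singleton _), h1,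
    Measure.prod_prod, Measure.smul_apply, ← Set.singleton_prod_singleton, Measure.prod_prod,
    uniformOn_univ_fin_singleton, uniformOn_univ_fin_singleton, smul_eq_mul]
  calc (M : ENNReal)⁻¹ * uniformOn (Set.univ : Set (Fin N)) {k | pad w k = s}
      ≤ (M : ENNReal)⁻¹ * (2 * (M : ENNReal)⁻¹) := by gcongr
    _ = _ := by ring

/-! ### Error probability and leakage of one-time pad codes. -/

/-- The code with codebooks `x₁`, `x₂` and decoders `d₁`, `d₂` that uses the key as a one-time
pad. -/
def otpCode {n M₁ M₂ : ℕ} (N : ℕ) (x₁ : Fin M₁ → Fin n → ℝ) (x₂ : Fin M₂ → Fin n → ℝ)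
    (d₁ : (Fin n → ℝ) → Fin M₁) (d₂ : (Fin n → ℝ) → Fin M₂) (hd₁ : Measurable d₁)
    (hd₂ : Measurable d₂) : Code n M₁ M₂ N where
  enc₁ := x₁
  enc₂ w k := x₂ (pad w k)
  dec₁ := d₁
  dec₂ y k := unpad (d₂ y) k
  measurable_dec₁ := hd₁
  measurable_dec₂ k := (measurable_of_countable fun s : Fin M₂ => unpad s k).comp hd₂

section otpCode

variable {n M₁ M₂ N : ℕ} (x₁ : Fin M₁ → Fin n → ℝ) (x₂ : Fin M₂ → Fin n → ℝ)
  (d₁ : (Fin n → ℝ) → Fin M₁) (d₂ : (Fin n → ℝ) → Fin M₂) (hd₁ : Measurable d₁)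
  (hd₂ : Measurable d₂)

theorem isOneTimePad_otpCode : (otpCode N x₁ x₂ d₁ d₂ hd₁ hd₂).IsOneTimePad :=
  ⟨⟨x₂, fun _ _ => rfl⟩, d₂, fun _ _ => pad_unpad _ _⟩

/-- The outcome without its structure as a nested product: the first message, the second message
with the key, and the two noise vectors. -/
theorem measurePreserving_assoc (hM₁ : 0 < M₁) (hM₂ : 0 < M₂) (hN : 0 < N) :
    MeasurePreserving
      (fun ω : Outcome n M₁ M₂ N => (ω.1, (ω.2.1, ω.2.2.1), ω.2.2.2))
      (blockLaw n M₁ M₂ N)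
      ((uniformOn Set.univ).prod (((uniformOn Set.univ).prod (uniformOn Set.univ)).prod
        ((noiseLaw n).prod (noiseLaw n)))) := by
  have := isProbabilityMeasure_uniformOn_fin hM₁
  have := isProbabilityMeasure_uniformOn_fin hM₂
  have := isProbabilityMeasure_uniformOn_fin hN
  exact (MeasurePreserving.id _).prod ((measurePreserving_prodAssoc _ _ _).symm _)

/-- The output at receiver 1 is a function of these three independent variables. -/
theorem measurePreserving_message_pad_noise (hM₁ : 0 < M₁) (hM₂ : 0 < M₂) (hN : 0 < N) :
    MeasurePreserving
      (fun ω : Outcome n M₁ M₂ N => (ω.1, pad ω.2.1 ω.2.2.1, ω.2.2.2.1))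
      (blockLaw n M₁ M₂ N)
      ((uniformOn Set.univ).prod ((uniformOn Set.univ).prod (noiseLaw n))) := by
  have := isProbabilityMeasure_uniformOn_fin hM₁
  have := isProbabilityMeasure_uniformOn_fin hM₂
  have := isProbabilityMeasure_uniformOn_fin hN
  exact ((MeasurePreserving.id _).prod ((measurePreserving_pad hN).prod
    measurePreserving_fst)).comp (measurePreserving_assoc hM₁ hM₂ hN)

/-- The component `()` indexes the absent interference at receiver 2, in the form that
`eventually_exists_codebook` expects. -/
theorem measurePreserving_pad_noise (hM₁ : 0 < M₁) (hM₂ : 0 < M₂) (hN : 0 < N) :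
    MeasurePreserving
      (fun ω : Outcome n M₁ M₂ N => (pad ω.2.1 ω.2.2.1, (), ω.2.2.2.2))
      (blockLaw n M₁ M₂ N)
      ((uniformOn Set.univ).prod ((Measure.dirac ()).prod (noiseLaw n))) := by
  have := isProbabilityMeasure_uniformOn_fin hM₁
  have := isProbabilityMeasure_uniformOn_fin hM₂
  have := isProbabilityMeasure_uniformOn_fin hN
  have h : MeasurePreserving (fun z : Fin n → ℝ => ((), z)) (noiseLaw n)
      ((Measure.dirac ()).prod (noiseLaw n)) :=
    ⟨measurable_prodMk_left, (Measure.dirac_prod _).symm⟩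
  exact ((measurePreserving_pad hN).prod (h.comp measurePreserving_snd)).comp
    (measurePreserving_snd.comp (measurePreserving_assoc hM₁ hM₂ hN))

/-- Union bound. Encryption with a given key is injective, so receiver 2 fails only if its estimate
of the encrypted message is wrong. -/
theorem measure_errorEvent_otpCode_le (hM₁ : 0 < M₁) (hM₂ : 0 < M₂) (hN : 0 < N)
    (h₁₁ h₂₁ h₂₂ : ℝ) :
    blockLaw n M₁ M₂ N ((otpCode N x₁ x₂ d₁ d₂ hd₁ hd₂).errorEvent h₁₁ h₂₁ h₂₂) ≤
      ((uniformOn Set.univ).prod ((uniformOn Set.univ).prod (noiseLaw n)))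
        {q : Fin M₁ × Fin M₂ × (Fin n → ℝ) |
          d₁ (fun t => h₁₁ * x₁ q.1 t + h₂₁ * x₂ q.2.1 t + q.2.2 t) ≠ q.1} +
      ((uniformOn Set.univ).prod ((Measure.dirac ()).prod (noiseLaw n)))
        {q : Fin M₂ × Unit × (Fin n → ℝ) |
          d₂ (fun t => h₂₂ * x₂ q.1 t + 0 + q.2.2 t) ≠ q.1} := by
  have m₁ : Measurable x₁ := measurable_of_countable _
  have m₂ : Measurable x₂ := measurable_of_countable _
  have s₁ : MeasurableSet {q : Fin M₁ × Fin M₂ × (Fin n → ℝ) |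
      d₁ (fun t => h₁₁ * x₁ q.1 t + h₂₁ * x₂ q.2.1 t + q.2.2 t) ≠ q.1} :=
    (measurableSet_eq_fun (hd₁.comp (by fun_prop)) measurable_fst).compl
  have s₂ : MeasurableSet {q : Fin M₂ × Unit × (Fin n → ℝ) |
      d₂ (fun t => h₂₂ * x₂ q.1 t + 0 + q.2.2 t) ≠ q.1} :=
    (measurableSet_eq_fun (hd₂.comp (by fun_prop)) measurable_fst).compl
  rw [← (measurePreserving_message_pad_noise hM₁ hM₂ hN).measure_preimage s₁.nullMeasurableSet,
    ← (measurePreserving_pad_noise hM₁ hM₂ hN).measure_preimage s₂.nullMeasurableSet]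
  refine (measure_mono ?_).trans (measure_union_le _ _)
  rintro ⟨w₁, w₂, k, z₁, z₂⟩ (h | h)
  · exact Or.inl h
  · refine Or.inr fun h' => h ?_
    have h2 : d₂ (fun t => h₂₂ * x₂ (pad w₂ k) t + z₂ t) = pad w₂ k := by
      simpa using h'
    refine pad_injective k ?_
    change pad (unpad (d₂ (fun t => h₂₂ * x₂ (pad w₂ k) t + z₂ t)) k) k = pad w₂ k
    rw [pad_unpad, h2]

/-- `W₁` and the noise are independent of `W₂` and the encrypted message. The domination of
`map_prod_pad_le` is therefore preserved by products with their laws and by the map to the output.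
-/
theorem leakage_otpCode_le (hM₁ : 0 < M₁) (hM₂ : 0 < M₂) (hMN : M₂ ≤ N) (h₁₁ h₂₁ : ℝ) :
    (otpCode N x₁ x₂ d₁ d₂ hd₁ hd₂).leakage h₁₁ h₂₁ ≤ ENNReal.ofReal (Real.log 2) := by
  have hN : 0 < N := hM₂.trans_le hMN
  have := isProbabilityMeasure_uniformOn_fin hM₁
  have := isProbabilityMeasure_uniformOn_fin hM₂
  have := isProbabilityMeasure_uniformOn_fin hN
  set c := otpCode N x₁ x₂ d₁ d₂ hd₁ hd₂ with hc
  set u₁ := uniformOn (Set.univ : Set (Fin M₁))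
  set u₂ := uniformOn (Set.univ : Set (Fin M₂))
  have : IsProbabilityMeasure (blockLaw n M₁ M₂ N) := by
    unfold blockLaw
    infer_instance
  set g : Fin M₁ × Fin M₂ × (Fin n → ℝ) → Fin n → ℝ := fun q t =>
    h₁₁ * x₁ q.1 t + h₂₁ * x₂ q.2.1 t + q.2.2 t with hg
  have m₁ : Measurable x₁ := measurable_of_countable _
  have m₂ : Measurable x₂ := measurable_of_countable _
  have hgm : Measurable g := by fun_prop
  have hmp := measurePreserving_message_pad_noise (n := n) hM₁ hM₂ hN
  have hout : c.out₁ h₁₁ h₂₁ =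
      g ∘ fun ω : Outcome n M₁ M₂ N => (ω.1, pad ω.2.1 ω.2.2.1, ω.2.2.2.1) := rfl
  have houtm : Measurable (c.out₁ h₁₁ h₂₁) := hout ▸ hgm.comp hmp.measurable
  have hmarg₁ : (blockLaw n M₁ M₂ N).map (c.out₁ h₁₁ h₂₁) =
      (u₁.prod (u₂.prod (noiseLaw n))).map g := by
    rw [hout, ← Measure.map_map hgm hmp.measurable, hmp.map_eq]
  have hmarg₂ : (blockLaw n M₁ M₂ N).map (fun ω => ω.2.1) = u₂ :=
    (measurePreserving_fst.comp measurePreserving_snd).map_eq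
  have hcomm : MeasurePreserving
      (fun q : Fin M₁ × (Fin M₂ × Fin M₂) × (Fin n → ℝ) => (q.2.1.1, q.1, q.2.1.2, q.2.2))
      (u₁.prod ((u₂.prod u₂).prod (noiseLaw n)))
      (u₂.prod (u₁.prod (u₂.prod (noiseLaw n)))) :=
    (measurePreserving_prodAssoc _ _ _).comp ((Measure.measurePreserving_swap.prod
      (MeasurePreserving.id _)).comp (((measurePreserving_prodAssoc _ _ _).symm _).comp
        ((MeasurePreserving.id _).prod (measurePreserving_prodAssoc _ _ _))))
  have hjm : Measurable fun q : Fin M₂ × Fin N => (q.1, pad q.1 q.2) := measurable_of_countable _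
  have hjoint : (blockLaw n M₁ M₂ N).map (fun ω => (ω.2.1, c.out₁ h₁₁ h₂₁ ω)) =
      (u₁.prod (((u₂.prod (uniformOn Set.univ)).map
        (fun q : Fin M₂ × Fin N => (q.1, pad q.1 q.2))).prod (noiseLaw n))).map
      (Prod.map id g ∘ fun q : Fin M₁ × (Fin M₂ × Fin M₂) × (Fin n → ℝ) =>
        (q.2.1.1, q.1, q.2.1.2, q.2.2)) := by
    have h1 : MeasurePreserving (fun q : Fin M₂ × Fin N => (q.1, pad q.1 q.2))
        (u₂.prod (uniformOn Set.univ)) _ := ⟨hjm, rfl⟩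
    have h2 := ((MeasurePreserving.id u₁).prod (h1.prod (measurePreserving_fst
      (μ := noiseLaw n) (ν := noiseLaw n)))).comp (measurePreserving_assoc (n := n) hM₁ hM₂ hN)
    rw [← h2.map_eq, Measure.map_map ((measurable_id.prodMap hgm).comp hcomm.measurable)
      h2.measurable]
    rfl
  have hle : (blockLaw n M₁ M₂ N).map (fun ω => (ω.2.1, c.out₁ h₁₁ h₂₁ ω)) ≤
      (2 : ENNReal) • (u₂.prod ((u₁.prod (u₂.prod (noiseLaw n))).map g)) := by
    rw [hjoint]
    calc _ ≤ ((2 : ENNReal) • (u₁.prod ((u₂.prod u₂).prod (noiseLaw n)))).map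
          (Prod.map id g ∘ fun q : Fin M₁ × (Fin M₂ × Fin M₂) × (Fin n → ℝ) =>
            (q.2.1.1, q.1, q.2.1.2, q.2.2)) := by
          refine Measure.map_mono ?_ ((measurable_id.prodMap hgm).comp hcomm.measurable)
          rw [← Measure.prod_smul_right, ← Measure.prod_smul_left]
          exact Measure.prod_mono le_rfl (Measure.prod_mono (map_prod_pad_le hM₂ hMN) le_rfl)
      _ = _ := by
          rw [Measure.map_smul, ← Measure.map_map (measurable_id.prodMap hgm) hcomm.measurable,
            hcomm.map_eq, ← Measure.map_prod_map _ _ measurable_id hgm, Measure.map_id]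
  have hw : Measurable fun ω : Outcome n M₁ M₂ N => ω.2.1 := by fun_prop
  have := Measure.isProbabilityMeasure_map (μ := blockLaw n M₁ M₂ N) (hw.prodMk houtm).aemeasurable
  have := Measure.isProbabilityMeasure_map (μ := u₁.prod (u₂.prod (noiseLaw n))) hgm.aemeasurable
  unfold Code.leakage mutualInfo
  rw [hmarg₁, hmarg₂]
  refine InformationTheory.klDiv_le_ofReal_log two_pos ?_
  simpa using hle

/-- At block length 0 the permitted leakage `n * ε n` is zero, so the bound `log 2` is not enough.
-/
theorem leakage_eq_zero_of_subsingleton (c : Code 0 M₁ M₂ N) (hM₁ : 0 < M₁) (hM₂ : M₂ = 1)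
    (hN : 0 < N) (h₁₁ h₂₁ : ℝ) : c.leakage h₁₁ h₂₁ = 0 := by
  subst hM₂
  have := isProbabilityMeasure_uniformOn_fin hM₁
  have := isProbabilityMeasure_uniformOn_fin one_pos
  have := isProbabilityMeasure_uniformOn_fin hN
  have : IsProbabilityMeasure (blockLaw 0 M₁ 1 N) := by
    unfold blockLaw
    infer_instance
  have hw : Measurable fun ω : Outcome 0 M₁ 1 N => ω.2.1 := by fun_prop
  have ho : Measurable (c.out₁ h₁₁ h₂₁) := by
    have : c.out₁ h₁₁ h₂₁ = fun _ => 0 := by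
      ext ω t
      exact t.elim0
    rw [this]
    exact measurable_const
  have := Measure.isProbabilityMeasure_map (μ := blockLaw 0 M₁ 1 N) (hw.prodMk ho).aemeasurable
  have := Measure.isProbabilityMeasure_map (μ := blockLaw 0 M₁ 1 N) hw.aemeasurable
  have := Measure.isProbabilityMeasure_map (μ := blockLaw 0 M₁ 1 N) ho.aemeasurable
  unfold Code.leakage mutualInfo
  rw [InformationTheory.klDiv_eq_zero_iff]
  ext s _
  rcases Set.Subsingleton.eq_empty_or_singleton (Set.subsingleton_of_subsingleton (s := s)) with
    rfl | ⟨a, rfl⟩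
  · simp
  · have : ({a} : Set (Fin 1 × (Fin 0 → ℝ))) = Set.univ :=
      Set.eq_univ_of_forall fun b => Subsingleton.elim b a
    rw [this, measure_univ, measure_univ]

end otpCode

/-! ### Power allocations and time sharing. -/

/-- Several phases may have the same power, so a set of times with equal power is a union of phases,
selected by `p`. -/
theorem sum_sq_filter_le {n : ℕ} {J : Type*} [Fintype J] [DecidableEq J] (φ : Fin n → J)
    (q : J → ℝ) (x : Fin n → ℝ)
    (hx : ∀ j, ∑ t with φ t = j, x t ^ 2 ≤ ((Finset.univ.filter fun t => φ t = j).card : ℝ) * q j)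
    (p : J → Prop) [DecidablePred p] :
    ∑ t with p (φ t), x t ^ 2 ≤ ∑ t with p (φ t), q (φ t) := by
  rw [Finset.sum_filter, Finset.sum_filter, ← Finset.sum_fiberwise Finset.univ φ,
    ← Finset.sum_fiberwise Finset.univ φ]
  refine Finset.sum_le_sum fun j _ => ?_
  have h1 : ∀ f : Fin n → ℝ, ∑ t with φ t = j, (if p (φ t) then f t else 0) =
      if p j then ∑ t with φ t = j, f t else 0 := by
    intro f
    split_ifs with hj
    · exact Finset.sum_congr rfl fun t ht => by rw [(Finset.mem_filter.1 ht).2, if_pos hj]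
    · exact Finset.sum_eq_zero fun t ht => by rw [(Finset.mem_filter.1 ht).2, if_neg hj]
  rw [h1, h1]
  split_ifs
  · refine (hx j).trans (le_of_eq ?_)
    rw [Finset.sum_congr rfl fun t ht => by rw [(Finset.mem_filter.1 ht).2]]
    simp
  · exact le_rfl

theorem sum_sq_le {n : ℕ} {J : Type*} [Fintype J] [DecidableEq J] (φ : Fin n → J)
    (q : J → ℝ) (x : Fin n → ℝ)
    (hx : ∀ j, ∑ t with φ t = j, x t ^ 2 ≤ ((Finset.univ.filter fun t => φ t = j).card : ℝ) * q j)
    {P : ℝ} (hq : ∀ j, q j ≤ P) : ∑ t, x t ^ 2 ≤ n * P := by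
  have h := sum_sq_filter_le φ q x hx (fun _ => True)
  simp only [Finset.filter_true] at h
  refine h.trans ((Finset.sum_le_sum fun t _ => hq (φ t)).trans (le_of_eq ?_))
  simp

/-- The minimum distance decoders complete two codebooks that obey power allocations `p` and `q` to
a code with the required properties. -/
theorem exists_otpCode {n M₁ M₂ N : ℕ} {J : Type*} [Fintype J] [DecidableEq J] (φ : Fin n → J)
    (h₁₁ h₂₁ h₂₂ P₁ P₂ : ℝ) (p q : J → ℝ) (hp : ∀ j, p j ≤ P₁) (hq0 : ∀ j, 0 ≤ q j)
    (hq : ∀ j, q j ≤ P₂) (hM₁ : 0 < M₁) (hM₂ : 0 < M₂) (hMN : M₂ ≤ N)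
    (x₁ : Fin M₁ → Fin n → ℝ) (x₂ : Fin M₂ → Fin n → ℝ)
    (hx₁ : ∀ w j, ∑ t with φ t = j, x₁ w t ^ 2 ≤
      ((Finset.univ.filter fun t => φ t = j).card : ℝ) * p j)
    (hx₂ : ∀ w j, ∑ t with φ t = j, x₂ w t ^ 2 ≤
      ((Finset.univ.filter fun t => φ t = j).card : ℝ) * q j) :
    ∃ (d₁ : (Fin n → ℝ) → Fin M₁) (d₂ : (Fin n → ℝ) → Fin M₂) (hd₁ : Measurable d₁)
      (hd₂ : Measurable d₂),
      (∀ y w, ∑ t, (y t - h₁₁ * x₁ (d₁ y) t) ^ 2 / (1 + h₂₁ ^ 2 * q (φ t)) ≤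
        ∑ t, (y t - h₁₁ * x₁ w t) ^ 2 / (1 + h₂₁ ^ 2 * q (φ t))) ∧
      (∀ y w, ∑ t, (y t - h₂₂ * x₂ (d₂ y) t) ^ 2 / (1 + 0) ≤
        ∑ t, (y t - h₂₂ * x₂ w t) ^ 2 / (1 + 0)) ∧
      (otpCode N x₁ x₂ d₁ d₂ hd₁ hd₂).PowerConstraint P₁ P₂ ∧
      (otpCode N x₁ x₂ d₁ d₂ hd₁ hd₂).IsOneTimePad ∧
      (otpCode N x₁ x₂ d₁ d₂ hd₁ hd₂).TreatsInterferenceAsNoise h₁₁ h₂₁ P₂ ∧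
      (otpCode N x₁ x₂ d₁ d₂ hd₁ hd₂).leakage h₁₁ h₂₁ ≤ ENNReal.ofReal (Real.log 2) := by
  obtain ⟨d₁, hd₁, hmin₁⟩ := exists_measurable_argmin hM₁
    (fun w (y : Fin n → ℝ) => ∑ t, (y t - h₁₁ * x₁ w t) ^ 2 / (1 + h₂₁ ^ 2 * q (φ t)))
    (fun w => by fun_prop)
  obtain ⟨d₂, hd₂, hmin₂⟩ := exists_measurable_argmin hM₂
    (fun w (y : Fin n → ℝ) => ∑ t, (y t - h₂₂ * x₂ w t) ^ 2 / (1 + 0))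
    (fun w => by fun_prop)
  refine ⟨d₁, d₂, hd₁, hd₂, hmin₁, hmin₂, ⟨fun w => sum_sq_le φ p _ (hx₁ w) hp,
    fun w k => sum_sq_le φ q _ (hx₂ _) hq⟩, isOneTimePad_otpCode _ _ _ _ _ _,
    ⟨fun t => q (φ t), fun t => ⟨hq0 _, hq _⟩, fun w k s => ?_, hmin₁⟩,
    leakage_otpCode_le _ _ _ _ _ _ hM₁ hM₂ hMN _ _⟩
  exact sum_sq_filter_le φ q _ (hx₂ _) (fun j => q j = q (φ s))

/-- Time sharing between finitely many power allocations, at rates strictly below the weighted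
averages of the capacities. -/
theorem mem_oneTimePadAchievable {J : Type*} [Fintype J] (lam p q : J → ℝ)
    (hlam : ∀ j, 0 < lam j) (hsum : ∑ j, lam j = 1) (h₁₁ h₂₁ h₂₂ P₁ P₂ RK R₁ R₂ : ℝ)
    (hp0 : ∀ j, 0 ≤ p j) (hp : ∀ j, p j ≤ P₁) (hq0 : ∀ j, 0 ≤ q j) (hq : ∀ j, q j ≤ P₂)
    (hR₁ : 0 ≤ R₁) (hR₂ : 0 ≤ R₂) (hRK : R₂ ≤ RK)
    (h₁ : R₁ = 0 ∨ R₁ * Real.log 2 <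
      ∑ j, lam j * (Real.log (1 + h₁₁ ^ 2 * p j / (1 + h₂₁ ^ 2 * q j)) / 2))
    (h₂ : R₂ = 0 ∨ R₂ * Real.log 2 <
      ∑ j, lam j * (Real.log (1 + h₂₂ ^ 2 * q j / (1 + 0)) / 2)) :
    (R₁, R₂) ∈ oneTimePadAchievable h₁₁ h₂₁ h₂₂ P₁ P₂ RK := by
  classical
  choose φ hφ using exists_phases lam (fun j => (hlam j).le) hsum
  have hM₁ := numIdx_pos hR₁
  have hM₂ := numIdx_pos hR₂
  have hMN := numIdx_mono hRK
  have hN : ∀ n, 0 < numIdx RK n := numIdx_pos (hR₂.trans hRK)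
  set Good : ∀ n, Code n (numIdx R₁ n) (numIdx R₂ n) (numIdx RK n) → Prop := fun n c =>
    c.PowerConstraint P₁ P₂ ∧ c.IsOneTimePad ∧ c.TreatsInterferenceAsNoise h₁₁ h₂₁ P₂ ∧
      c.leakage h₁₁ h₂₁ ≤ ENNReal.ofReal (Real.log 2)
  set err : ∀ n, Code n (numIdx R₁ n) (numIdx R₂ n) (numIdx RK n) → ENNReal := fun n c =>
    blockLaw n (numIdx R₁ n) (numIdx R₂ n) (numIdx RK n) (c.errorEvent h₁₁ h₂₁ h₂₂)
  -- Zero codebooks serve the short block lengths, about which the coding theorem says nothing.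
  have hne : ∀ n, ∃ c, Good n c := by
    intro n
    obtain ⟨d₁, d₂, hd₁, hd₂, -, -, h⟩ := exists_otpCode (N := numIdx RK n) (φ n) h₁₁ h₂₁ h₂₂ P₁ P₂
      p q hp hq0 hq (hM₁ n) (hM₂ n) (hMN n) (fun _ _ => 0) (fun _ _ => 0)
      (fun w j => by have := hp0 j; simp; positivity)
      (fun w j => by have := hq0 j; simp; positivity)
    exact ⟨_, h⟩
  have hsmall : ∀ ε : ℝ, 0 < ε → ∀ᶠ n in atTop, ∃ c, Good n c ∧ err n c ≤ ENNReal.ofReal ε := by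
    intro ε hε
    filter_upwards [eventually_exists_codebook lam p (fun j => h₂₁ ^ 2 * q j) h₁₁ hlam hp0
        (fun j => mul_nonneg (sq_nonneg _) (hq0 j)) h₁ (half_pos hε),
      eventually_exists_codebook lam q (fun _ => 0) h₂₂ hlam hq0 (fun _ => le_rfl) h₂
        (half_pos hε)] with n hn₁ hn₂
    -- The codebook `x₂` comes first, as receiver 2 sees no interference. Then `x₁` is chosen
    -- against the interference `h₂₁ x₂`.
    obtain ⟨x₂, hx₂, herr₂⟩ := hn₂ (φ n) (hφ n) Unit (Measure.dirac ()) (fun _ _ => 0)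
      measurable_const (fun _ _ => by simp)
    have := isProbabilityMeasure_uniformOn_fin (hM₂ n)
    obtain ⟨x₁, hx₁, herr₁⟩ := hn₁ (φ n) (hφ n) (Fin (numIdx R₂ n)) (uniformOn Set.univ)
      (fun s t => h₂₁ * x₂ s t) (measurable_of_countable _) (fun s j => by
        simp only [mul_pow]
        rw [← Finset.mul_sum, mul_left_comm]
        exact mul_le_mul_of_nonneg_left (hx₂ s j) (sq_nonneg _))
    obtain ⟨d₁, d₂, hd₁, hd₂, hmin₁, hmin₂, h⟩ := exists_otpCode (N := numIdx RK n) (φ n)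
      h₁₁ h₂₁ h₂₂ P₁ P₂ p q hp hq0 hq (hM₁ n) (hM₂ n) (hMN n) x₁ x₂ hx₁ hx₂
    refine ⟨_, h, (measure_errorEvent_otpCode_le x₁ x₂ d₁ d₂ hd₁ hd₂ (hM₁ n) (hM₂ n) (hN n)
      h₁₁ h₂₁ h₂₂).trans ?_⟩
    calc _ ≤ ENNReal.ofReal (ε / 2) + ENNReal.ofReal (ε / 2) :=
          add_le_add (herr₁ d₁ hd₁ hmin₁) (herr₂ d₂ hd₂ hmin₂)
      _ = ENNReal.ofReal ε := by
          rw [← ENNReal.ofReal_add (by positivity) (by positivity), add_halves]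
  obtain ⟨c, hc, hlim⟩ := exists_seq_tendsto_zero Good err hne hsmall
  refine ⟨hR₁, hR₂, c, fun n => (hc n).1, fun n => (hc n).2.1, fun n => (hc n).2.2.1, hlim,
    fun n => Real.log 2 / n, tendsto_const_div_atTop_nhds_zero_nat _, fun n => ?_⟩
  -- For `n = 0` the value `Real.log 2 / n` is `0` by convention, and the leakage must vanish
  -- exactly.
  rcases n.eq_zero_or_pos with rfl | hn
  · rw [leakage_eq_zero_of_subsingleton _ (hM₁ 0) (numIdx_zero_right R₂) (hN 0)]
    exact zero_le
  · have hn' : (n : ℝ) ≠ 0 := by exact_mod_cast hn.ne'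
    rw [mul_div_cancel₀ _ hn']
    exact (hc n).2.2.2

/-! ### Passage to the convex hull and the closure. -/

/-- Scaling makes the inequality strict only for a positive rate; a zero rate stays zero, which
matters when `B = 0`. -/
theorem eq_zero_or_mul_lt {R B e : ℝ} (hR : 0 ≤ R) (he : 0 < e) (hB : R * Real.log 2 ≤ B) :
    (1 - e) * R = 0 ∨ (1 - e) * R * Real.log 2 < B := by
  rcases hR.eq_or_lt with rfl | hR
  · exact Or.inl (mul_zero _)
  · refine Or.inr (lt_of_lt_of_le ?_ hB)
    have h2 : 0 < R * Real.log 2 := mul_pos hR (Real.log_pos one_lt_two)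
    nlinarith [mul_pos he h2]

theorem mul_log_le_of_le_logb {R x : ℝ} (h : R ≤ 0.5 * Real.logb 2 x) :
    R * Real.log 2 ≤ Real.log x / 2 := by
  have hlog : 0 < Real.log 2 := Real.log_pos one_lt_two
  calc R * Real.log 2 ≤ 0.5 * Real.logb 2 x * Real.log 2 := by gcongr
    _ = Real.log x / 2 := by
      rw [Real.logb]
      field_simp
      ring

end GaussianZIC
end

theorem theorem2 (h₁₁ h₂₁ h₂₂ P₁ P₂ RK : ℝ) (hP₁ : 0 ≤ P₁) (hP₂ : 0 ≤ P₂) (hRK : 0 ≤ RK) :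
    convexHull ℝ (⋃ β₁ ∈ Set.Icc (0 : ℝ) 1, ⋃ β₂ ∈ Set.Icc (0 : ℝ) 1,
      GaussianZIC.rateRegion h₁₁ h₂₁ h₂₂ P₁ P₂ RK β₁ β₂) ⊆
    closure (GaussianZIC.oneTimePadAchievable h₁₁ h₂₁ h₂₂ P₁ P₂ RK) := by
  intro R hR
  -- Strictly positive weights make the length of every phase grow with `n`, as the concentration of
  -- its power requires.
  obtain ⟨J, _, z, lam, hz, -, hlam, hsum, rfl⟩ := eq_pos_convex_span_of_mem_convexHull hR
  have hmem : ∀ j, ∃ β₁ β₂ : ℝ, (0 ≤ β₁ ∧ β₁ ≤ 1) ∧ (0 ≤ β₂ ∧ β₂ ≤ 1) ∧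
      z j ∈ GaussianZIC.rateRegion h₁₁ h₂₁ h₂₂ P₁ P₂ RK β₁ β₂ := by
    intro j
    have := hz (Set.mem_range_self j)
    simp only [Set.mem_iUnion, Set.mem_Icc, exists_prop] at this
    obtain ⟨β₁, hβ₁, β₂, hβ₂, h⟩ := this
    exact ⟨β₁, β₂, hβ₁, hβ₂, h⟩
  choose β₁ β₂ hβ₁ hβ₂ hreg using hmem
  have hfst : (∑ j, lam j • z j).1 = ∑ j, lam j * (z j).1 := by simp [Prod.fst_sum]
  have hsnd : (∑ j, lam j • z j).2 = ∑ j, lam j * (z j).2 := by simp [Prod.snd_sum]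
  have hR₁ : 0 ≤ ∑ j, lam j * (z j).1 :=
    Finset.sum_nonneg fun j _ => mul_nonneg (hlam j).le (hreg j).1
  have hR₂ : 0 ≤ ∑ j, lam j * (z j).2 :=
    Finset.sum_nonneg fun j _ => mul_nonneg (hlam j).le (hreg j).2.1
  -- One key serves the whole block, so only the averaged rate has to stay below `RK`.
  have hRK' : ∑ j, lam j * (z j).2 ≤ RK := by
    calc ∑ j, lam j * (z j).2 ≤ ∑ j, lam j * RK := Finset.sum_le_sum fun j _ =>
          mul_le_mul_of_nonneg_left ((hreg j).2.2.2.trans (min_le_left _ _)) (hlam j).le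
      _ = RK := by rw [← Finset.sum_mul, hsum, one_mul]
  have hB₁ : (∑ j, lam j * (z j).1) * Real.log 2 ≤ ∑ j, lam j *
      (Real.log (1 + h₁₁ ^ 2 * (β₁ j * P₁) / (1 + h₂₁ ^ 2 * (β₂ j * P₂))) / 2) := by
    rw [Finset.sum_mul]
    refine Finset.sum_le_sum fun j _ => ?_
    have h := GaussianZIC.mul_log_le_of_le_logb (hreg j).2.2.1
    rw [mul_assoc, ← mul_assoc (h₁₁ ^ 2), ← mul_assoc (h₂₁ ^ 2)]
    exact mul_le_mul_of_nonneg_left h (hlam j).le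
  have hB₂ : (∑ j, lam j * (z j).2) * Real.log 2 ≤ ∑ j, lam j *
      (Real.log (1 + h₂₂ ^ 2 * (β₂ j * P₂) / (1 + 0)) / 2) := by
    rw [Finset.sum_mul]
    refine Finset.sum_le_sum fun j _ => ?_
    have h := GaussianZIC.mul_log_le_of_le_logb ((hreg j).2.2.2.trans (min_le_right _ _))
    rw [mul_assoc, ← mul_assoc (h₂₂ ^ 2), add_zero, div_one]
    exact mul_le_mul_of_nonneg_left h (hlam j).le
  have hlim : Tendsto (fun e : ℝ => ((1 - e) * ∑ j, lam j * (z j).1, (1 - e) * ∑ j, lam j * (z j).2))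
      (𝓝[>] 0) (𝓝 (∑ j, lam j • z j)) := by
    have h : Continuous fun e : ℝ =>
        ((1 - e) * ∑ j, lam j * (z j).1, (1 - e) * ∑ j, lam j * (z j).2) := by fun_prop
    have h0 := (h.tendsto 0).mono_left (nhdsWithin_le_nhds (s := Set.Ioi 0))
    simp only [sub_zero, one_mul] at h0
    rwa [show ∑ j, lam j • z j = (∑ j, lam j * (z j).1, ∑ j, lam j * (z j).2) from
      Prod.ext hfst hsnd]
  refine mem_closure_of_tendsto hlim ?_
  filter_upwards [Ioo_mem_nhdsGT (zero_lt_one (α := ℝ))] with e he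
  have he1 : 0 ≤ 1 - e := by linarith [he.2]
  refine GaussianZIC.mem_oneTimePadAchievable lam (fun j => β₁ j * P₁) (fun j => β₂ j * P₂) hlam hsum
    h₁₁ h₂₁ h₂₂ P₁ P₂ RK _ _ (fun j => mul_nonneg (hβ₁ j).1 hP₁)
    (fun j => mul_le_of_le_one_left hP₁ (hβ₁ j).2) (fun j => mul_nonneg (hβ₂ j).1 hP₂)
    (fun j => mul_le_of_le_one_left hP₂ (hβ₂ j).2) (mul_nonneg he1 hR₁) (mul_nonneg he1 hR₂) ?_
    (GaussianZIC.eq_zero_or_mul_lt hR₁ he.1 hB₁) (GaussianZIC.eq_zero_or_mul_lt hR₂ he.1 hB₂)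
  exact (mul_le_of_le_one_left hR₂ (by linarith [he.1])).trans hRK'
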